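/- Let $\mathbb A$ be a relational structure with finite universe $A$ and finitely many basic relations, each of finite positive arity. An instance $I$ of $\mathrm{CSP}(\mathbb A)$ consists of a finite set $V$ of variables and a set of constraints $R(\sigma)$, where $R$ is a basic relation and $\sigma$ a tuple over $V$ of length the arity of $R$; $I$ is satisfiable if some $f\colon V\to A$ has $f(\sigma)\in R$ for every constraint $R(\sigma)$ of $I$. A Datalog program for $\mathrm{CSP}(\mathbb A)$ is a finite list of rules $R(\rho)\leftarrow S_1(\sigma_1),\dots,S_\ell(\sigma_\ell)$ with predicates of positive arity, among them one for each basic relation of $\mathbb A$, and with some predicates designated as goals; run on $I$, it starts from the constraints of $I$ and derives all statements obtainable by its rules. It decides $\mathrm{CSP}(\mathbb A)$ if, on every instance $I$, it derives a statement about a goal predicate if and only if $I$ is unsatisfiable. An IDB is a predicate occurring on the left-hand side of some rule. The program is linear if every rule has at most one IDB on its right-hand side. It is symmetric if it is linear and with every rule $R(\rho)\leftarrow S(\sigma),T_1(\tau_1),\dots$ in which $S$ is an IDB it also contains the mirror image $S(\sigma)\leftarrow R(\rho),T_1(\tau_1),\dots$. An instance $(V,\mathcal C)$ has pathwidth at most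 $k$ if $V$ is covered by a sequence of sets $U_1,\dots,U_m$ of size at most $k+1$ such that $U_i\cap U_l\subseteq U_j$ whenever $i<j<l$ and the scope of every constraint lies inside some $U_i$. $\mathbb A$ has bounded pathwidth duality if there is $k$ such that for every unsatisfiable instance $I$ there is an unsatisfiable instance $J$ of pathwidth at most $k$ from which a subinstance of $I$ is obtained by identifying variables. For a positive integer $r$, the $r$-ary maximal symmetric Datalog program consistent with $\mathbb A$, denoted $\mathcal P^r_{\mathbb A}$, has as predicates all relations on $A$ of arity between $1$ and $r$ (its IDBs) and separate symbols for the basic relations of arity at most $r$ (never IDBs). Its rules are all rules over the variables $x_1,\dots,x_r$ that have an IDB on the left-hand side, at most one IDB on the right-hand side and no repeated statement on the right-hand side, that are consistent with $\mathbb A$ (the implication the rule expresses holds in $\mathbb A$ for all assignments of elements of $A$ to the variables), and whose mirror image, if there is an IDB on the right-hand side, is also consistent with $\mathbb A$. Its goal predicates are the empty relations of arity at most $r$. **Theorem.** Suppose that some linear Datalog program decides $\mathrm{CSP}(\mathbb A)$, or that $\mathbb A$ has bounded pathwidth duality. Suppose also that for some integer $n\ge 1$ there are ternary polymorphisms $p_0,\dots,p_n$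 of $\mathbb A$ with $$p_0(x,y,z)=x,\qquad p_i(x,x,y)=p_{i+1}(x,y,y)\ \ (0\le i<n),\qquad p_n(x,y,z)=z$$ for all $x,y,z\in A$ (a chain of Hagemann–Mitschke polymorphisms). Then there is a positive integer $r$ such that $\mathcal P^r_{\mathbb A}$ decides $\mathrm{CSP}(\mathbb A)$. In particular, some symmetric Datalog program decides $\mathrm{CSP}(\mathbb A)$. -/

import Mathlib

universe u v

namespace SymDatalog

/-! ## Relational structures, polymorphisms, constraint satisfaction -/

/-- A relational structure with universe `A`: a finite family of relations on `A` (the basic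
relations), each of positive finite arity. -/
structure RelStructure (A : Type u) where
  Symb : Type v
  finite_symb : Finite Symb
  arity : Symb → ℕ
  arity_pos : ∀ R, 0 < arity R
  rel : ∀ R, Set (Fin (arity R) → A)

/-- A statement `R(σ)`: a symbol `R` together with a tuple `σ` over `X` of length the arity
of `R`. -/
structure Atom {S : Type*} (ar : S → ℕ) (X : Type*) where
  pred : S
  args : Fin (ar pred) → X

/-- `R(σ)` becomes `R(ω(σ))`. -/
def Atom.map {S : Type*} {ar : S → ℕ} {X Y : Type*} (ω : X → Y) (a : Atom ar X) : Atom ar Y :=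
  ⟨a.pred, ω ∘ a.args⟩

namespace RelStructure

variable {A : Type u}

/-- The operation `t` is a polymorphism of `𝔸`: it preserves every basic relation. -/
def IsPolymorphism (𝔸 : RelStructure.{u, v} A) {m : ℕ} (t : (Fin m → A) → A) : Prop :=
  ∀ (R : 𝔸.Symb) (x : Fin m → Fin (𝔸.arity R) → A), (∀ i, x i ∈ 𝔸.rel R) →
    (fun j => t (fun i => x i j)) ∈ 𝔸.rel R

/-- `𝔸` admits a chain `p₀, …, pₙ` of Hagemann–Mitschke operations as polymorphisms
(these identities force every `pᵢ` to be idempotent). -/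
def HasHagemannMitschke (𝔸 : RelStructure.{u, v} A) (n : ℕ) : Prop :=
  ∃ p : Fin (n + 1) → (Fin 3 → A) → A,
    (∀ i, 𝔸.IsPolymorphism (p i)) ∧
    (∀ x y z, p 0 ![x, y, z] = x) ∧
    (∀ (i : Fin n) (x y : A), p i.castSucc ![x, x, y] = p i.succ ![x, y, y]) ∧
    (∀ x y z, p (Fin.last n) ![x, y, z] = z)

/-- An instance of `CSP(𝔸)` with variable set `V`, given by its set of constraints `R(σ)`. -/
abbrev Instance (𝔸 : RelStructure.{u, v} A) (V : Type*) := Set (Atom 𝔸.arity V)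

/-- The instance has a solution. -/
def Satisfiable (𝔸 : RelStructure.{u, v} A) {V : Type*} (I : 𝔸.Instance V) : Prop :=
  ∃ f : V → A, ∀ c ∈ I, f ∘ c.args ∈ 𝔸.rel c.pred

/-- The instance has pathwidth at most `k`. -/
def PathwidthAtMost (𝔸 : RelStructure.{u, v} A) {V : Type*} (I : 𝔸.Instance V) (k : ℕ) : Prop :=
  ∃ (m : ℕ) (U : Fin m → Finset V),
    (∀ x, ∃ i, x ∈ U i) ∧
    (∀ i, (U i).card ≤ k + 1) ∧
    (∀ i j l : Fin m, i < j → j < l → ∀ x, x ∈ U i → x ∈ U l → x ∈ U j) ∧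
    (∀ c ∈ I, ∃ i, ∀ t, c.args t ∈ U i)

/-- Bounded pathwidth duality: for some `k`, every unsatisfiable (finite) instance `I` admits an
unsatisfiable instance `J` of pathwidth at most `k` which becomes a subinstance of `I` when
variables are identified by some map `h`. -/
def HasBoundedPathwidthDuality (𝔸 : RelStructure.{u, v} A) : Prop :=
  ∃ k : ℕ, ∀ (V : Type) [Finite V] (I : 𝔸.Instance V), ¬ 𝔸.Satisfiable I →
    ∃ (W : Type) (_ : Finite W) (J : 𝔸.Instance W),
      ¬ 𝔸.Satisfiable J ∧ 𝔸.PathwidthAtMost J k ∧ ∃ h : W → V, ∀ c ∈ J, c.map h ∈ I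

end RelStructure

/-! ## Datalog -/

/-- A Datalog rule `head ← body` with variables from `X`. -/
@[ext] structure Rule {S : Type*} (ar : S → ℕ) (X : Type*) where
  head : Atom ar X
  body : List (Atom ar X)

/-- For a rule with body `l₁, a, l₂`, the rule obtained by switching its head and `a`. -/
def Rule.mirror {S : Type*} {ar : S → ℕ} {X : Type*} (α : Rule ar X)
    (l₁ : List (Atom ar X)) (a : Atom ar X) (l₂ : List (Atom ar X)) : Rule ar X :=
  ⟨a, l₁ ++ α.head :: l₂⟩

/-- A Datalog program for `CSP(𝔸)`. Its predicates are the symbols of the basic relations of `𝔸`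
together with finitely many auxiliary predicates of positive arity; it has finitely many
variables and finitely many rules. -/
structure Program {A : Type u} (𝔸 : RelStructure.{u, v} A) where
  Aux : Type u
  finite_aux : Finite Aux
  auxArity : Aux → ℕ
  auxArity_pos : ∀ S, 0 < auxArity S
  numVars : ℕ
  rules : Set (Rule (Sum.elim 𝔸.arity auxArity) (Fin numVars))
  finite_rules : rules.Finite
  goals : Set (𝔸.Symb ⊕ Aux)

namespace Program

variable {A : Type u} {𝔸 : RelStructure.{u, v} A}

/-- The predicates of a program, and their arities. -/
abbrev Pred (P : Program 𝔸) := 𝔸.Symb ⊕ P.Aux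

abbrev arity (P : Program 𝔸) : P.Pred → ℕ := Sum.elim 𝔸.arity P.auxArity

/-- `P.Derives I a`: the program `P` run on the instance `I` derives the statement `a`. -/
inductive Derives (P : Program 𝔸) {V : Type*} (I : 𝔸.Instance V) : Atom P.arity V → Prop
  | load (c : Atom 𝔸.arity V) (hc : c ∈ I) : Derives P I ⟨Sum.inl c.pred, c.args⟩
  | step (α : Rule P.arity (Fin P.numVars)) (hα : α ∈ P.rules) (ω : Fin P.numVars → V)
      (hb : ∀ a ∈ α.body, Derives P I (a.map ω)) : Derives P I (α.head.map ω)

/-- `P` run on `I` derives some statement about a goal predicate. -/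
def ReachesGoal (P : Program 𝔸) {V : Type*} (I : 𝔸.Instance V) : Prop :=
  ∃ a : Atom P.arity V, a.pred ∈ P.goals ∧ P.Derives I a

/-- `P` decides `CSP(𝔸)`: on every finite instance, it reaches a goal predicate if and only if
the instance is unsatisfiable. -/
def Decides (P : Program 𝔸) : Prop :=
  ∀ (V : Type) [Finite V] (I : 𝔸.Instance V), P.ReachesGoal I ↔ ¬ 𝔸.Satisfiable I

/-- Intensional predicates (IDBs): those occurring on the left hand side of some rule. -/
def IsIDB (P : Program 𝔸) (S : P.Pred) : Prop := ∃ α ∈ P.rules, α.head.pred = S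

/-- Linear programs: the right hand side of every rule has at most one IDB statement, i.e. no
two positions of the body both carry an IDB. -/
def IsLinear (P : Program 𝔸) : Prop :=
  ∀ α ∈ P.rules, α.body.Pairwise fun a b => ¬ (P.IsIDB a.pred ∧ P.IsIDB b.pred)

/-- Symmetric programs: linear programs which contain, with each rule having an IDB on its right
hand side, also the mirror image of that rule. -/
def IsSymmetric (P : Program 𝔸) : Prop :=
  P.IsLinear ∧ ∀ α ∈ P.rules, ∀ l₁ a l₂, α.body = l₁ ++ a :: l₂ → P.IsIDB a.pred →
    α.mirror l₁ a l₂ ∈ P.rules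

end Program

/-! ## The maximal symmetric Datalog program -/

section Maximal

variable {A : Type u}

/-- The relations on `A` of (positive) arity at most `r`. -/
abbrev RelAtMost (A : Type u) (r : ℕ) : Type u :=
  Σ n : Finset.Icc 1 r, Set (Fin (n : ℕ) → A)

/-- The arity of such a relation. -/
def RelAtMost.arity {r : ℕ} (S : RelAtMost A r) : ℕ := S.1

/-- Arity of the predicates used by the maximal symmetric program. -/
abbrev maxArity (𝔸 : RelStructure.{u, v} A) (r : ℕ) : 𝔸.Symb ⊕ RelAtMost A r → ℕ :=
  Sum.elim 𝔸.arity RelAtMost.arity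

/-- The relation on `A` to which a predicate of the maximal symmetric program corresponds. -/
def predRel (𝔸 : RelStructure.{u, v} A) (r : ℕ) :
    (p : 𝔸.Symb ⊕ RelAtMost A r) → Set (Fin (maxArity 𝔸 r p) → A)
  | Sum.inl R => 𝔸.rel R
  | Sum.inr S => S.2

/-- A rule is consistent with `𝔸` if the corresponding implication holds in `𝔸` under every
assignment of elements to variables. -/
def Consistent (𝔸 : RelStructure.{u, v} A) (r : ℕ) {X : Type*} (α : Rule (maxArity 𝔸 r) X) :
    Prop :=
  ∀ f : X → A, (∀ a ∈ α.body, f ∘ a.args ∈ predRel 𝔸 r a.pred) →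
    f ∘ α.head.args ∈ predRel 𝔸 r α.head.pred

/-- The rules of the `r`-ary maximal symmetric program. The IDBs are the predicates
`Sum.inr S`, where `S` is any relation on `A` of arity at most `r`; the predicates `Sum.inl R`
are the separate symbols for the basic relations, only those of arity at most `r` being used. -/
structure IsMaxRule (𝔸 : RelStructure.{u, v} A) (r : ℕ) (α : Rule (maxArity 𝔸 r) (Fin r)) :
    Prop where
  head_idb : α.head.pred.isRight
  linear : α.body.Pairwise fun a b => ¬ (a.pred.isRight ∧ b.pred.isRight)
  arity_le : ∀ a ∈ α.body, maxArity 𝔸 r a.pred ≤ r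
  nodup : α.body.Nodup
  consistent : Consistent 𝔸 r α
  mirror_consistent : ∀ l₁ a l₂, α.body = l₁ ++ a :: l₂ → a.pred.isRight →
    Consistent 𝔸 r (α.mirror l₁ a l₂)

instance {S : Type*} [Finite S] (ar : S → ℕ) (X : Type*) [Finite X] : Finite (Atom ar X) :=
  Finite.of_injective (β := Σ s, (Fin (ar s) → X)) (fun a => ⟨a.pred, a.args⟩)
    (by rintro ⟨p, s⟩ ⟨q, t⟩ h; cases h; rfl)

theorem finite_maxRules [Finite A] (𝔸 : RelStructure.{u, v} A) (r : ℕ) :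
    {α | IsMaxRule 𝔸 r α}.Finite := by
  classical
  have := 𝔸.finite_symb
  have : Fintype (Atom (maxArity 𝔸 r) (Fin r)) := Fintype.ofFinite _
  let g : {α | IsMaxRule 𝔸 r α} → Atom (maxArity 𝔸 r) (Fin r) ×
      {l : List (Atom (maxArity 𝔸 r) (Fin r)) // l.Nodup} :=
    fun α => (α.1.head, ⟨α.1.body, α.2.nodup⟩)
  have hg : Function.Injective g := by
    rintro ⟨α, hα⟩ ⟨β, hβ⟩ h
    simp only [g, Prod.mk.injEq, Subtype.mk.injEq] at h
    exact Subtype.ext (Rule.ext h.1 h.2)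
  exact Set.finite_coe_iff.mp (Finite.of_injective g hg)

/-- The `r`-ary maximal symmetric Datalog program consistent with `𝔸`. Its goal predicates are the
empty relations of arity at most `r`. -/
def maxSymProgram [Finite A] (𝔸 : RelStructure.{u, v} A) (r : ℕ) : Program 𝔸 where
  Aux := RelAtMost A r
  finite_aux := inferInstance
  auxArity := RelAtMost.arity
  auxArity_pos := fun S => (Finset.mem_Icc.mp S.1.2).1
  numVars := r
  rules := {α | IsMaxRule 𝔸 r α}
  finite_rules := finite_maxRules 𝔸 r
  goals := {p | ∃ S : RelAtMost A r, p = Sum.inr S ∧ S.2 = ∅}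

end Maximal

end SymDatalog

open SymDatalog

namespace SymDatalog

/-! ## Factorization forests -/

section Forest

variable {S : Type*} [Monoid S]

theorem exists_eq_mul_pow_of_eq_mul_mul [Finite S] {a s c : S} (h : s = a * s * c) :
    ∃ n, s = s * c ^ (n + 1) := by
  have hk : ∀ k : ℕ, s = a ^ k * s * c ^ k := by
    intro k
    induction k with
    | zero => simp
    | succ k ih =>
      calc s = a ^ k * (a * s * c) * c ^ k := by rw [← h]; exact ih
        _ = a ^ (k + 1) * s * c ^ (k + 1) := by
          rw [pow_succ a, pow_succ' c]; simp only [mul_assoc]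
  obtain ⟨i, j, hij, hc⟩ := Set.finite_univ.exists_lt_map_eq_of_forall_mem
    (f := fun k : ℕ => c ^ k) (fun _ => Set.mem_univ _)
  obtain ⟨n, rfl⟩ : ∃ n, j = i + (n + 1) := ⟨j - i - 1, by omega⟩
  refine ⟨n, ?_⟩
  have hc' : c ^ i = c ^ i * c ^ (n + 1) := by rw [← pow_add]; exact hc
  calc s = a ^ i * s * c ^ i := hk i
    _ = a ^ i * s * c ^ i * c ^ (n + 1) := by rw [mul_assoc _ (c ^ i), ← hc']
    _ = s * c ^ (n + 1) := by rw [← hk i]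

theorem exists_eq_pow_mul_of_eq_mul_mul [Finite S] {a s c : S} (h : s = a * s * c) :
    ∃ n, s = a ^ (n + 1) * s := by
  have : Finite Sᵐᵒᵖ := Finite.of_injective _ MulOpposite.unop_injective
  obtain ⟨n, hn⟩ := exists_eq_mul_pow_of_eq_mul_mul (S := Sᵐᵒᵖ) (a := MulOpposite.op c)
    (s := MulOpposite.op s) (c := MulOpposite.op a) (by
      rw [← MulOpposite.op_mul, ← MulOpposite.op_mul, ← mul_assoc, ← h])
  exact ⟨n, MulOpposite.op_injective (by simpa using hn)⟩

/-- The two-sided ideal generated by `s`. -/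
def twoSided (s : S) : Set S := {x | ∃ a b, x = a * s * b}

theorem twoSided_mul_left (s t : S) : twoSided (s * t) ⊆ twoSided t := by
  rintro x ⟨a, b, rfl⟩
  exact ⟨a * s, b, by simp only [mul_assoc]⟩

theorem twoSided_mul_right (s t : S) : twoSided (s * t) ⊆ twoSided s := by
  rintro x ⟨a, b, rfl⟩
  exact ⟨a, t * b, by simp only [mul_assoc]⟩

theorem mem_twoSided (s : S) : s ∈ twoSided s := ⟨1, 1, by simp⟩

theorem exists_eq_mul_left [Finite S] {s t : S} (h : twoSided t ⊆ twoSided (s * t)) :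
    ∃ x, t = x * (s * t) := by
  obtain ⟨a, b, hab⟩ := h (mem_twoSided t)
  obtain ⟨n, hn⟩ := exists_eq_pow_mul_of_eq_mul_mul (a := a * s) (s := t) (c := b)
    (by simpa only [mul_assoc] using hab)
  exact ⟨(a * s) ^ n * a, by rw [pow_succ] at hn; simpa only [mul_assoc] using hn⟩

theorem exists_eq_mul_right [Finite S] {s t : S} (h : twoSided s ⊆ twoSided (s * t)) :
    ∃ x, s = s * t * x := by
  obtain ⟨a, b, hab⟩ := h (mem_twoSided s)
  obtain ⟨n, hn⟩ := exists_eq_mul_pow_of_eq_mul_mul (a := a) (s := s) (c := t * b)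
    (by simpa only [mul_assoc] using hab)
  exact ⟨b * (t * b) ^ n, by rw [pow_succ'] at hn; simpa only [mul_assoc] using hn⟩

/-- A family `G d` of sets of intervals, `d` being thought of as a height, which is closed under
concatenation of two intervals and under concatenation of any number of intervals carrying the
same idempotent label. -/
structure ForestClosed (σ : ℕ → ℕ → S) (G : ℕ → ℕ → ℕ → Prop) : Prop where
  base : ∀ i, G 0 i (i + 1)
  mul : ∀ i j k, i < j → j < k → σ i j * σ j k = σ i k
  mono : ∀ d i j, G d i j → G (d + 1) i j
  binary : ∀ d i j k, i < j → j < k → G d i j → G d j k → G (d + 1) i k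
  idem : ∀ d e (t : ℕ) (pos : ℕ → ℕ), e * e = e → 0 < t →
    (∀ a < t, pos a < pos (a + 1) ∧ σ (pos a) (pos (a + 1)) = e ∧ G d (pos a) (pos (a + 1))) →
    G (d + 1) (pos 0) (pos t)

theorem ForestClosed.mono_le {σ : ℕ → ℕ → S} {G : ℕ → ℕ → ℕ → Prop} (H : ForestClosed σ G)
    {d d' i j : ℕ} (h : d ≤ d') (hG : G d i j) : G d' i j := by
  induction h with
  | refl => exact hG
  | step _ ih => exact H.mono _ _ _ ih

theorem lt_of_lt_step {pos : ℕ → ℕ} {t : ℕ} (h : ∀ a < t, pos a < pos (a + 1)) {a b : ℕ}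
    (hab : a < b) (hb : b ≤ t) : pos a < pos b := by
  induction b, hab using Nat.le_induction with
  | base => exact h a (by omega)
  | succ b _ ih => exact (ih (by omega)).trans (h b (by omega))

theorem labels_between_same_colour [Finite S] {σ : ℕ → ℕ → S} {t : ℕ}
    (mul : ∀ i j k, i < j → j < k → k ≤ t → σ i j * σ j k = σ i k)
    (hJ : ∀ a b a' b', a < b → b ≤ t → a' < b' → b' ≤ t →
      twoSided (σ a b) = twoSided (σ a' b'))
    {a b : ℕ} (h0 : 0 < a) (hab : a < b) (hbt : b < t)
    (hl : σ 0 a = σ 0 b) (hr : σ a t = σ b t) :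
    σ a b * σ a b = σ a b ∧ ∀ c, b < c → c < t → σ 0 b = σ 0 c → σ b t = σ c t →
      σ b c = σ a b := by
  have hp : σ 0 a * σ a b = σ 0 a := by rw [mul _ _ _ h0 hab hbt.le, hl]
  have key : ∀ a b, 0 < a → a < b → b < t → σ 0 a = σ 0 b → ∃ x, σ a b = x * σ 0 a := by
    intro a b h0 hab hbt hl
    have : twoSided (σ a b) ⊆ twoSided (σ 0 a * σ a b) := by
      rw [mul _ _ _ h0 hab hbt.le]
      exact (hJ _ _ _ _ hab hbt.le (h0.trans hab) hbt.le).subset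
    obtain ⟨x, hx⟩ := exists_eq_mul_left this
    rw [mul _ _ _ h0 hab hbt.le, ← hl] at hx
    exact ⟨x, hx⟩
  obtain ⟨x, hx⟩ := key a b h0 hab hbt hl
  constructor
  · nth_rewrite 1 [hx]
    rw [mul_assoc, hp, ← hx]
  · intro c hbc hct hl' hr'
    have hpf : σ 0 a * σ b c = σ 0 a := by
      rw [hl, mul _ _ _ (h0.trans hab) hbc hct.le, hl']
    have h1 : σ a b * σ b c = σ a b := by
      rw [hx, mul_assoc, hpf]
    have : twoSided (σ b c) ⊆ twoSided (σ b c * σ c t) := by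
      rw [mul _ _ _ hbc hct le_rfl]
      exact (hJ _ _ _ _ hbc hct.le (hbc.trans hct) le_rfl).subset
    obtain ⟨y, hy⟩ := exists_eq_mul_right this
    rw [mul _ _ _ hbc hct le_rfl] at hy
    have hq : σ a b * σ b t = σ b t := by rw [mul _ _ _ hab hbt le_rfl, hr]
    have h2 : σ a b * σ b c = σ b c := by
      rw [hy, ← mul_assoc, hq]
    rw [← h1, h2]

/-- The case of a word all of whose factors generate the same two-sided ideal. -/
theorem ForestClosed.of_twoSided_eq [Finite S] {σ : ℕ → ℕ → S} {G : ℕ → ℕ → ℕ → Prop}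
    (H : ForestClosed σ G) {d t : ℕ} (pos : ℕ → ℕ) (ht : 0 < t)
    (hpos : ∀ a < t, pos a < pos (a + 1))
    (hG : ∀ a < t, G d (pos a) (pos (a + 1)))
    (hJ : ∀ a b a' b', a < b → b ≤ t → a' < b' → b' ≤ t →
      twoSided (σ (pos a) (pos b)) = twoSided (σ (pos a') (pos b'))) :
    G (d + 3 * Nat.card (S × S)) (pos 0) (pos t) := by
  classical
  set τ : ℕ → ℕ → S := fun a b => σ (pos a) (pos b) with hτ
  have hlt : ∀ {a b}, a < b → b ≤ t → pos a < pos b := fun h h' => lt_of_lt_step hpos h h'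
  have mul : ∀ i j k, i < j → j < k → k ≤ t → τ i j * τ j k = τ i k := fun i j k h h' h'' =>
    H.mul _ _ _ (hlt h (by omega)) (hlt h' h'')
  let χ : ℕ → S × S := fun a => (τ 0 a, τ a t)
  have claim : ∀ k x y, x < y → y ≤ t → ((Finset.Ioo x y).image χ).card ≤ k →
      G (d + 3 * k) (pos x) (pos y) := by
    intro k
    induction k with
    | zero =>
      intro x y hxy hy hc
      have : Finset.Ioo x y = ∅ := by simpa using hc
      have hy' : y = x + 1 := by
        by_contra hne
        have : x + 1 ∈ Finset.Ioo x y := Finset.mem_Ioo.2 ⟨by omega, by omega⟩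
        simp_all
      subst hy'
      exact hG x (by omega)
    | succ k ih =>
      intro x y hxy hy hc
      by_cases hy' : y = x + 1
      · subst hy'
        exact H.mono_le (by omega) (hG x (by omega))
      let s := (Finset.Ioo x y).filter fun a => χ a = χ (x + 1)
      have hs0 : x + 1 ∈ s := by simp [s]; omega
      have small : ∀ x' y', x ≤ x' → x' < y' → y' ≤ y → (∀ a ∈ s, ¬ (x' < a ∧ a < y')) →
          G (d + 3 * k) (pos x') (pos y') := by
        intro x' y' h1 h2 h3 h4
        refine ih x' y' h2 (by omega) ?_
        have hsub : (Finset.Ioo x' y').image χ ⊆ ((Finset.Ioo x y).image χ).erase (χ (x + 1)) := by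
          intro c hc
          obtain ⟨a, ha, rfl⟩ := Finset.mem_image.1 hc
          rw [Finset.mem_Ioo] at ha
          have hm : a ∈ Finset.Ioo x y := Finset.mem_Ioo.2 ⟨by omega, by omega⟩
          refine Finset.mem_erase.2 ⟨fun h => h4 a (Finset.mem_filter.2 ⟨hm, h⟩) ha, ?_⟩
          exact Finset.mem_image_of_mem _ hm
        have := Finset.card_le_card hsub
        rw [Finset.card_erase_of_mem (Finset.mem_image_of_mem _
          (Finset.mem_filter.1 hs0).1)] at this
        omega
      obtain ⟨m, hm⟩ : ∃ m, s.card = m + 1 :=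
        ⟨s.card - 1, by have := Finset.card_pos.2 ⟨_, hs0⟩; omega⟩
      let E := s.orderEmbOfFin hm
      let q : ℕ → ℕ := fun a => E (Fin.ofNat (m + 1) a)
      have hval : ∀ a, a ≤ m → ((Fin.ofNat (m + 1) a : Fin (m + 1)) : ℕ) = a := fun a ha => by
        simp [Fin.ofNat]; omega
      have hmem : ∀ a, q a ∈ s := fun a => s.orderEmbOfFin_mem hm _
      have hq : ∀ a b, a ≤ m → b ≤ m → (q a < q b ↔ a < b) := by
        intro a b ha hb
        rw [show q a < q b ↔ _ from E.lt_iff_lt, Fin.lt_def, hval a ha, hval b hb]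
      have hsurj : ∀ c ∈ s, ∃ a, a ≤ m ∧ q a = c := by
        intro c hc
        have : c ∈ Set.range E := by rw [Finset.range_orderEmbOfFin]; exact hc
        obtain ⟨a, rfl⟩ := this
        refine ⟨a, by omega, ?_⟩
        simp only [q]
        congr 1
        exact Fin.ext (hval a (by omega))
      have hbd : ∀ a, x < q a ∧ q a < y := fun a =>
        Finset.mem_Ioo.1 (Finset.mem_filter.1 (hmem a)).1
      have hχ : ∀ a, χ (q a) = χ (x + 1) := fun a => (Finset.mem_filter.1 (hmem a)).2
      have hl : ∀ a b, τ 0 (q a) = τ 0 (q b) := fun a b =>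
        congrArg Prod.fst ((hχ a).trans (hχ b).symm)
      have hr : ∀ a b, τ (q a) t = τ (q b) t := fun a b =>
        congrArg Prod.snd ((hχ a).trans (hχ b).symm)
      have first : G (d + 3 * k) (pos x) (pos (q 0)) := by
        refine small x (q 0) le_rfl (hbd 0).1 (hbd 0).2.le ?_
        rintro c hc ⟨-, h⟩
        obtain ⟨a, ha, rfl⟩ := hsurj c hc
        rw [hq a 0 ha (by omega)] at h
        omega
      have last : G (d + 3 * k) (pos (q m)) (pos y) := by
        refine small (q m) y (hbd m).1.le (hbd m).2 le_rfl ?_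
        rintro c hc ⟨h, -⟩
        obtain ⟨a, ha, rfl⟩ := hsurj c hc
        rw [hq m a le_rfl ha] at h
        omega
      have upto : G (d + 3 * k + 2) (pos x) (pos (q m)) := by
        rcases Nat.eq_zero_or_pos m with h0 | h0
        · rw [h0]; exact H.mono_le (by omega) first
        refine H.binary (d + 3 * k + 1) _ (pos (q 0)) _ (hlt (hbd 0).1 ((hbd 0).2.le.trans hy))
          (hlt ((hq 0 m (by omega) le_rfl).2 h0) ((hbd m).2.le.trans hy))
          (H.mono_le (by omega) first) ?_
        have hstep : ∀ a < m, q a < q (a + 1) := fun a ha =>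
          (hq a (a + 1) (by omega) (by omega)).2 (by omega)
        have hlab : ∀ a < m, τ (q a) (q (a + 1)) = τ (q 0) (q 1) := by
          intro a
          induction a with
          | zero => intro _; rfl
          | succ a iha =>
            intro ha
            rw [← iha (by omega)]
            exact (labels_between_same_colour mul hJ (by have := hbd a; omega)
              (hstep a (by omega)) (by have := hbd (a + 1); omega) (hl _ _) (hr _ _)).2 _
              (hstep _ ha) (by have := hbd (a + 1 + 1); omega) (hl _ _) (hr _ _)
        refine H.idem (d + 3 * k) (τ (q 0) (q 1)) m (fun a => pos (q a)) ?_ h0 ?_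
        · exact (labels_between_same_colour mul hJ (by have := hbd 0; omega)
              (hstep 0 h0) (by have := hbd (0 + 1); omega) (hl _ _) (hr _ _)).1
        · intro a ha
          refine ⟨hlt (hstep a ha) ((hbd _).2.le.trans hy), hlab a ha, ?_⟩
          refine small _ _ (hbd a).1.le (hstep a ha) (hbd (a + 1)).2.le ?_
          rintro c hc ⟨h, h'⟩
          obtain ⟨b, hb, rfl⟩ := hsurj c hc
          rw [hq _ _ (by omega) hb] at h
          rw [hq _ _ hb (by omega)] at h'
          omega
      exact H.binary (d + 3 * k + 2) _ _ _ (hlt (hbd m).1 ((hbd m).2.le.trans hy))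
        (hlt (hbd m).2 hy) upto (H.mono_le (by omega) last)
  refine claim _ 0 t ht le_rfl ?_
  rw [← Nat.card_eq_finsetCard]
  exact Nat.card_le_card_of_injective _ Subtype.val_injective

theorem ForestClosed.twoSided_subset {σ : ℕ → ℕ → S} {G : ℕ → ℕ → ℕ → Prop}
    (H : ForestClosed σ G) {i i' j' j : ℕ} (h1 : i ≤ i') (h2 : i' < j') (h3 : j' ≤ j) :
    twoSided (σ i j) ⊆ twoSided (σ i' j') := by
  have hA : twoSided (σ i j) ⊆ twoSided (σ i j') := by
    rcases h3.eq_or_lt with rfl | h3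
    · exact subset_rfl
    · rw [← H.mul i j' j (by omega) h3]
      exact twoSided_mul_right _ _
  refine hA.trans ?_
  rcases h1.eq_or_lt with rfl | h1
  · exact subset_rfl
  · rw [← H.mul i i' j' h1 h2]
    exact twoSided_mul_left _ _

/-- Cutting an interval greedily into blocks that generate the ideal `J`. -/
theorem ForestClosed.exists_blocks {σ : ℕ → ℕ → S} {G : ℕ → ℕ → ℕ → Prop}
    (H : ForestClosed σ G) {h j : ℕ} (J : Set S) {i : ℕ} (hij : i ≤ j)
    (hG : ∀ i' j', i ≤ i' → i' < j' → j' ≤ j → twoSided (σ i' j') ≠ J → G h i' j') :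
    ∃ (t : ℕ) (pos : ℕ → ℕ), pos 0 = i ∧ pos t ≤ j ∧
      (∀ a < t, pos a < pos (a + 1) ∧ G (h + 1) (pos a) (pos (a + 1)) ∧
        twoSided (σ (pos a) (pos (a + 1))) = J) ∧
      (pos t < j → twoSided (σ (pos t) j) ≠ J) := by
  classical
  induction hd : j - i using Nat.strong_induction_on generalizing i with
  | _ d ih =>
  by_cases hex : ∃ k, i < k ∧ k ≤ j ∧ twoSided (σ i k) = J
  · have hk := Nat.find_spec hex
    have hmin := fun k (hk : k < Nat.find hex) => Nat.find_min hex hk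
    set k := Nat.find hex
    obtain ⟨hik, hkj, hkJ⟩ := hk
    have hGk : G (h + 1) i k := by
      by_cases h1 : k = i + 1
      · rw [h1]; exact H.mono_le (by omega) (H.base i)
      · refine H.binary h i (k - 1) k (by omega) (by omega) ?_ ?_
        · refine hG _ _ le_rfl (by omega) (by omega) fun hJ => ?_
          exact hmin (k - 1) (by omega) ⟨by omega, by omega, hJ⟩
        · have := H.base (k - 1)
          rw [Nat.sub_add_cancel (by omega)] at this
          exact H.mono_le (by omega) this
    obtain ⟨t, pos, h0, ht, hb, he⟩ := ih (j - k) (by omega) hkj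
      (fun i' j' h1 h2 h3 => hG i' j' (by omega) h2 h3) rfl
    refine ⟨t + 1, fun a => Nat.casesOn a i pos, rfl, ht, ?_, he⟩
    rintro (_ | a) ha
    · simp only [h0]
      exact ⟨hik, hGk, hkJ⟩
    · exact hb a (by omega)
  · refine ⟨0, fun _ => i, rfl, hij, by simp, fun hlt hJ => hex ⟨j, hlt, le_rfl, hJ⟩⟩

/-- A weak form of Simon's factorization forest theorem. -/
theorem exists_forest_height (S : Type*) [Monoid S] [Finite S] :
    ∃ h : ℕ, ∀ (σ : ℕ → ℕ → S) (G : ℕ → ℕ → ℕ → Prop), ForestClosed σ G →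
      ∀ i j, i < j → G h i j := by
  suffices hk : ∀ k : ℕ, ∃ h : ℕ, ∀ (σ : ℕ → ℕ → S) (G : ℕ → ℕ → ℕ → Prop), ForestClosed σ G →
      ∀ i j, i < j → Nat.card S + 1 ≤ (twoSided (σ i j)).ncard + k → G h i j by
    obtain ⟨h, hh⟩ := hk (Nat.card S + 1)
    exact ⟨h, fun σ G H i j hij => hh σ G H i j hij (by omega)⟩
  intro k
  induction k with
  | zero =>
    refine ⟨0, fun σ G _ i j _ hc => ?_⟩
    have := Set.ncard_le_card (twoSided (σ i j))
    omega
  | succ k ih =>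
    obtain ⟨h, hh⟩ := ih
    refine ⟨h + 1 + 3 * Nat.card (S × S) + 1, fun σ G H i j hij hc => ?_⟩
    obtain ⟨t, pos, h0, ht, hb, he⟩ := H.exists_blocks (h := h) (twoSided (σ i j)) hij.le (by
      intro i' j' h1 h2 h3 hne
      refine hh σ G H i' j' h2 ?_
      have := Set.ncard_lt_ncard ((H.twoSided_subset h1 h2 h3).ssubset_of_ne hne.symm)
      omega)
    have htpos : 0 < t := by
      rcases Nat.eq_zero_or_pos t with rfl | h
      · exact absurd (by rw [h0]) (he (by omega))
      · exact h
    have hlt : ∀ {a b}, a < b → b ≤ t → pos a < pos b := fun h h' =>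
      lt_of_lt_step (fun a ha => (hb a ha).1) h h'
    have hle : ∀ {a b}, a ≤ b → b ≤ t → pos a ≤ pos b := fun h h' => by
      rcases h.eq_or_lt with rfl | h
      · exact le_rfl
      · exact (hlt h h').le
    have hJ : ∀ a b, a < b → b ≤ t → twoSided (σ (pos a) (pos b)) = twoSided (σ i j) := by
      intro a b hab hbt
      refine subset_antisymm ?_ (H.twoSided_subset ?_ (hlt hab hbt) ((hle hbt le_rfl).trans ht))
      · rw [← (hb a (by omega)).2.2]
        exact H.twoSided_subset le_rfl (hb a (by omega)).1 (hle hab hbt)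
      · rw [← h0]; exact hle (Nat.zero_le _) (by omega)
    have main := H.of_twoSided_eq pos htpos (fun a ha => (hb a ha).1) (fun a ha => (hb a ha).2.1)
      (fun a b a' b' h1 h2 h3 h4 => (hJ a b h1 h2).trans (hJ a' b' h3 h4).symm)
    rw [h0] at main
    rcases ht.eq_or_lt with ht | ht
    · rw [← ht]; exact H.mono _ _ _ main
    · refine H.binary _ i (pos t) j (h0 ▸ hlt htpos le_rfl) ht main (H.mono_le ?_
        (hh σ G H _ _ ht ?_))
      · omega
      · have hi : i ≤ pos t := h0 ▸ (hlt htpos le_rfl).le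
        have := Set.ncard_lt_ncard ((H.twoSided_subset hi ht le_rfl).ssubset_of_ne (he ht).symm)
        omega

end Forest
/-! ## Symmetric derivations of semantic statements -/

section SymDer

variable {A : Type u} {𝔸 : RelStructure.{u, v} A} {V : Type*}

/-- The assignment `f` satisfies all constraints of `I` whose scope lies in `X`. -/
def LocalSol (I : 𝔸.Instance V) (X : Set V) (f : V → A) : Prop :=
  ∀ c ∈ I, (∀ t, c.args t ∈ X) → f ∘ c.args ∈ 𝔸.rel c.pred

theorem LocalSol.anti {I : 𝔸.Instance V} {X Y : Set V} {f : V → A} (hXY : X ⊆ Y)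
    (h : LocalSol I Y f) : LocalSol I X f :=
  fun c hc ht => h c hc fun t => hXY (ht t)

/-- The property `Φ` of assignments depends on the values at points of `X` only. -/
def Determined (X : Finset V) (Φ : (V → A) → Prop) : Prop :=
  ∀ f g : V → A, (∀ x ∈ X, f x = g x) → Φ f → Φ g

theorem Determined.mono {X Y : Finset V} {Φ : (V → A) → Prop} (h : Determined X Φ)
    (hXY : X ⊆ Y) : Determined Y Φ :=
  fun f g hfg => h f g fun x hx => hfg x (hXY hx)

theorem Determined.and {X : Finset V} {Φ Ψ : (V → A) → Prop} (h : Determined X Φ)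
    (h' : Determined X Ψ) : Determined X (fun f => Φ f ∧ Ψ f) :=
  fun f g hfg hf => ⟨h f g hfg hf.1, h' f g hfg hf.2⟩

/-- The relation on `A` that a property of assignments defines along `σ`. -/
def relAlong {n : ℕ} (σ : Fin n → V) (Φ : (V → A) → Prop) : Set (Fin n → A) :=
  {s | ∃ f, f ∘ σ = s ∧ Φ f}

theorem comp_mem_relAlong {n : ℕ} {σ : Fin n → V} {Φ : (V → A) → Prop} {X : Finset V}
    (hΦ : Determined X Φ) (hσ : ∀ x ∈ X, ∃ i, σ i = x) (f : V → A) :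
    f ∘ σ ∈ relAlong σ Φ ↔ Φ f := by
  constructor
  · rintro ⟨g, hg, hΦg⟩
    refine hΦ g f (fun x hx => ?_) hΦg
    obtain ⟨i, rfl⟩ := hσ x hx
    exact congrFun hg i
  · exact fun h => ⟨f, rfl, h⟩

theorem Program.Derives.congr {P : Program 𝔸} {I : 𝔸.Instance V} {a b : Atom P.arity V}
    (h : P.Derives I a) (hab : a = b) : P.Derives I b := hab ▸ h

theorem exists_edb_list [Finite A] (I : 𝔸.Instance V) {r : ℕ} (har : ∀ R, 𝔸.arity R ≤ r)
    (Z : Set V) (ι : V → Fin r) (ω : Fin r → V) (hω : ∀ z ∈ Z, ω (ι z) = z) :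
    ∃ L : List (Atom (maxArity 𝔸 r) (Fin r)), L.Nodup ∧
      (∀ a ∈ L, ¬ a.pred.isRight ∧ maxArity 𝔸 r a.pred ≤ r ∧
        (maxSymProgram 𝔸 r).Derives I (a.map ω)) ∧
      ∀ f : Fin r → A, (∀ a ∈ L, f ∘ a.args ∈ predRel 𝔸 r a.pred) → LocalSol I Z (f ∘ ι) := by
  classical
  have := 𝔸.finite_symb
  let T : Set (Atom (maxArity 𝔸 r) (Fin r)) :=
    {a | ∃ c ∈ I, (∀ t, c.args t ∈ Z) ∧ a = ⟨Sum.inl c.pred, ι ∘ c.args⟩}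
  have hT : T.Finite := Set.toFinite T
  refine ⟨hT.toFinset.toList, Finset.nodup_toList _, ?_, ?_⟩
  · intro a ha
    rw [Finset.mem_toList, Set.Finite.mem_toFinset] at ha
    obtain ⟨c, hc, hcZ, rfl⟩ := ha
    refine ⟨by simp, har _, ?_⟩
    have : (⟨Sum.inl c.pred, ι ∘ c.args⟩ : Atom (maxArity 𝔸 r) (Fin r)).map ω =
        ⟨Sum.inl c.pred, c.args⟩ := by
      simp only [Atom.map]
      congr 1
      funext t
      exact hω _ (hcZ t)
    exact Program.Derives.congr (P := maxSymProgram 𝔸 r) (.load c hc) this.symm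
  · intro f hf c hc hcZ
    exact hf ⟨Sum.inl c.pred, ι ∘ c.args⟩ (by
      rw [Finset.mem_toList, Set.Finite.mem_toFinset]
      exact ⟨c, hc, hcZ, rfl⟩)

theorem exists_naming [DecidableEq V] (Z : Finset V) {r : ℕ} (hZ : Z.Nonempty) (hr : Z.card ≤ r) :
    ∃ (ι : V → Fin r) (ω : Fin r → V), ∀ z ∈ Z, ω (ι z) = z := by
  obtain ⟨z0, hz0⟩ := hZ
  have hpos : 0 < Z.card := Finset.card_pos.2 ⟨z0, hz0⟩
  refine ⟨fun v => if h : v ∈ Z then Fin.castLE hr (Z.equivFin ⟨v, h⟩) else ⟨0, by omega⟩,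
    fun k => if h : (k : ℕ) < Z.card then (Z.equivFin.symm ⟨k, h⟩ : Z) else z0, ?_⟩
  intro z hz
  simp [hz]

variable [DecidableEq V]

/-- `SymDer I r X Φ`: the statement `Φ` about the variables in `X` can be derived from `I` by
reversible steps each of which involves at most `r` variables. -/
inductive SymDer (I : 𝔸.Instance V) (r : ℕ) : Finset V → ((V → A) → Prop) → Prop
  | start (X : Finset V) (Φ : (V → A) → Prop) (hX : X.Nonempty) (hr : X.card ≤ r)
      (hΦ : Determined X Φ) (h : ∀ f, LocalSol I X f → Φ f) : SymDer I r X Φ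
  | step (X Y : Finset V) (Φ Ψ : (V → A) → Prop) (hd : SymDer I r X Φ) (hY : Y.Nonempty)
      (hr : (X ∪ Y).card ≤ r) (hΨ : Determined Y Ψ)
      (h : ∀ f, LocalSol I ↑(X ∪ Y) f → (Φ f ↔ Ψ f)) : SymDer I r Y Ψ

namespace SymDer

variable {I : 𝔸.Instance V} {r : ℕ} {X Y Z : Finset V} {Φ Ψ Θ : (V → A) → Prop}

theorem mono {r' : ℕ} (h : SymDer I r X Φ) (hr : r ≤ r') : SymDer I r' X Φ := by
  induction h with
  | start X Φ hX hc hΦ h => exact .start X Φ hX (hc.trans hr) hΦ h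
  | step X Y Φ Ψ _ hY hc hΨ h ih => exact .step X Y Φ Ψ ih hY (hc.trans hr) hΨ h

theorem card_le (h : SymDer I r X Φ) : X.card ≤ r := by
  cases h with
  | start _ _ _ hr => exact hr
  | step X' _ _ _ _ _ hr => exact (Finset.card_le_card Finset.subset_union_right).trans hr

theorem nonempty (h : SymDer I r X Φ) : X.Nonempty := by
  cases h with
  | start _ _ hX => exact hX
  | step _ _ _ _ _ hY => exact hY

theorem determined (h : SymDer I r X Φ) : Determined X Φ := by
  cases h with
  | start _ _ _ _ hΦ => exact hΦ
  | step _ _ _ _ _ _ _ hΨ => exact hΨ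

theorem card_union_le' {M : ℕ} (h : Z.card + r ≤ M) {X Y : Finset V} (hXY : (X ∪ Y).card ≤ r) :
    ((Z ∪ X) ∪ (Z ∪ Y)).card ≤ M := by
  rw [← Finset.union_union_distrib_left]
  exact (Finset.card_union_le _ _).trans (by omega)

/-- Any derivation can be performed in the presence of an additional statement. -/
theorem add {M : ℕ} (h : SymDer I r X Φ) (hM : Z.card + r ≤ M) (hZ : SymDer I M Z Θ) :
    SymDer I M (Z ∪ X) (fun f => Θ f ∧ Φ f) := by
  induction h with
  | start X Φ hX hr hΦ h =>
    refine .step Z _ Θ _ hZ hZ.nonempty.inl ?_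
      ((hZ.determined.mono Finset.subset_union_left).and (hΦ.mono Finset.subset_union_right)) ?_
    · rw [← Finset.union_assoc, Finset.union_self]
      exact (Finset.card_union_le _ _).trans (by omega)
    · intro f hf
      refine ⟨fun h' => ⟨h', h f (hf.anti ?_)⟩, fun h' => h'.1⟩
      intro x hx
      simp_all
  | step X Y Φ Ψ _ hY hr hΨ h ih =>
    refine .step _ _ _ _ ih hZ.nonempty.inl (card_union_le' hM hr)
      ((hZ.determined.mono Finset.subset_union_left).and (hΨ.mono Finset.subset_union_right)) ?_
    intro f hf
    rw [h f (hf.anti ?_)]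
    intro x hx
    simp only [Finset.coe_union, Set.mem_union] at hx ⊢
    tauto

/-- A derivation performed in the presence of an additional statement can be undone. -/
theorem drop {M : ℕ} (h : SymDer I r X Φ) (hM : Z.card + r ≤ M) (hZ : Z.Nonempty)
    (hΘ : Determined Z Θ) (hd : SymDer I M (Z ∪ X) (fun f => Θ f ∧ Φ f)) : SymDer I M Z Θ := by
  induction h with
  | start X Φ hX hr hΦ h =>
    refine .step _ Z _ Θ hd hZ ?_ hΘ ?_
    · rw [Finset.union_comm, ← Finset.union_assoc, Finset.union_self]
      exact (Finset.card_union_le _ _).trans (by omega)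
    · intro f hf
      refine ⟨fun h' => h'.1, fun h' => ⟨h', h f (hf.anti ?_)⟩⟩
      intro x hx
      simp_all
  | step X Y Φ Ψ hX hY hr hΨ h ih =>
    refine ih (.step _ _ _ _ hd hZ.inl ?_
      ((hΘ.mono Finset.subset_union_left).and (hX.determined.mono Finset.subset_union_right)) ?_)
    · exact card_union_le' hM (by rwa [Finset.union_comm])
    intro f hf
    rw [h f (hf.anti ?_)]
    intro x hx
    simp only [Finset.coe_union, Set.mem_union] at hx ⊢
    tauto

/-- A derived statement can be used like a constraint in a reversible step. -/
theorem step_of {M : ℕ} (h : SymDer I r X Φ) (hd : SymDer I M Y Θ) (hZ : Z.Nonempty)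
    (hM : (Y ∪ Z).card + r ≤ M) (hΨ : Determined Z Ψ) (hst : ∀ f, Φ f → (Θ f ↔ Ψ f)) :
    SymDer I M Z Ψ := by
  have h1 : Y.card ≤ (Y ∪ Z).card := Finset.card_le_card Finset.subset_union_left
  have h2 : Z.card ≤ (Y ∪ Z).card := Finset.card_le_card Finset.subset_union_right
  refine drop h (by omega) hZ hΨ (.step _ _ _ _ (h.add (by omega) hd) hZ.inl ?_
    ((hΨ.mono Finset.subset_union_left).and (h.determined.mono Finset.subset_union_right)) ?_)
  · rw [← Finset.union_union_distrib_right]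
    have := h.card_le
    exact (Finset.card_union_le _ _).trans (by omega)
  · intro f _
    constructor
    · exact fun h' => ⟨(hst f h'.2).1 h'.1, h'.2⟩
    · exact fun h' => ⟨(hst f h'.2).2 h'.1, h'.2⟩

theorem of_imp {M : ℕ} (h : SymDer I r X Φ) (hZ : Z.Nonempty) (hM : Z.card + r ≤ M)
    (hΨ : Determined Z Ψ) (hst : ∀ f, Φ f → Ψ f) : SymDer I M Z Ψ := by
  refine h.step_of (Y := Z) (Θ := fun _ => True) (.start _ _ hZ (by omega) ?_ ?_) hZ ?_ hΨ ?_
  · exact fun _ _ _ h => h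
  · simp
  · rwa [Finset.union_self]
  · intro f hf
    simp [hst f hf]

theorem and {r' : ℕ} (h : SymDer I r X Φ) (h' : SymDer I r' Y Ψ) :
    SymDer I (r + r') (X ∪ Y) (fun f => Φ f ∧ Ψ f) :=
  h'.add (by have := h.card_le; omega) (h.mono (by omega))

theorem forall_lt {s : ℕ} {X : ℕ → Finset V} {Φ : ℕ → (V → A) → Prop} (hs : 0 < s)
    (h : ∀ a < s, SymDer I r (X a) (Φ a)) :
    SymDer I (s * r) ((Finset.range s).biUnion X) (fun f => ∀ a < s, Φ a f) := by
  induction s, hs using Nat.le_induction with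
  | base => simpa using h 0 (by omega)
  | succ s hs ih =>
    have := (ih fun a ha => h a (by omega)).and (h s (by omega))
    rw [Finset.range_add_one, Finset.biUnion_insert, Finset.union_comm, Nat.succ_mul]
    convert this using 1
    funext f
    simp only [eq_iff_iff]
    exact Nat.forall_lt_succ_right

end SymDer

/-! ## Realising symmetric derivations by the maximal symmetric program -/

theorem SymDer.derives [Finite A] {I : 𝔸.Instance V} {r : ℕ} (har : ∀ R, 𝔸.arity R ≤ r)
    {X : Finset V} {Φ : (V → A) → Prop} (h : SymDer I r X Φ) (n : Finset.Icc 1 r)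
    (σ : Fin n → V) (hσX : ∀ i, σ i ∈ X) (hXσ : ∀ x ∈ X, ∃ i, σ i = x) :
    (maxSymProgram 𝔸 r).Derives I ⟨Sum.inr ⟨n, relAlong σ Φ⟩, σ⟩ := by
  induction h generalizing n with
  | start X Φ hX hr hΦ h =>
    obtain ⟨ι, ω, hω⟩ := exists_naming X hX hr
    obtain ⟨L, hL1, hL2, hL3⟩ := exists_edb_list I har (X : Set V) ι ω hω
    let α : Rule (maxArity 𝔸 r) (Fin r) := ⟨⟨Sum.inr ⟨n, relAlong σ Φ⟩, ι ∘ σ⟩, L⟩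
    have hα : IsMaxRule 𝔸 r α :=
      { head_idb := rfl
        linear := List.Pairwise.imp_of_mem (R := fun _ _ => True)
          (fun {a b} ha _ _ h' => (hL2 a ha).1 h'.1) (List.pairwise_of_forall fun _ _ => trivial)
        arity_le := fun a ha => (hL2 a ha).2.1
        nodup := hL1
        consistent := fun f hf =>
          (comp_mem_relAlong hΦ hXσ (f ∘ ι)).2 (h _ (hL3 f hf))
        mirror_consistent := fun l₁ a l₂ hb ha =>
          absurd ha (hL2 a (by rw [show L = _ from hb]; simp)).1 }
    have := Program.Derives.step (P := maxSymProgram 𝔸 r) (I := I) α hα ω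
      fun a ha => (hL2 a ha).2.2
    have heq : α.head.map ω = ⟨Sum.inr ⟨n, relAlong σ Φ⟩, σ⟩ := by
      simp only [α, Atom.map]
      congr 1
      funext t
      exact hω _ (hσX t)
    exact this.congr heq
  | step X Y Φ Ψ hd hY hr hΨ h ih =>
    have hXc : X.card ∈ Finset.Icc 1 r :=
      Finset.mem_Icc.2 ⟨Finset.card_pos.2 hd.nonempty, hd.card_le⟩
    let τ : Fin X.card → V := fun i => X.equivFin.symm i
    have hτX : ∀ i, τ i ∈ X := fun i => (X.equivFin.symm i).2
    have hXτ : ∀ x ∈ X, ∃ i, τ i = x := fun x hx => ⟨X.equivFin ⟨x, hx⟩, by simp [τ]⟩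
    have hder := ih ⟨X.card, hXc⟩ τ hτX hXτ
    obtain ⟨ι, ω, hω⟩ := exists_naming (X ∪ Y) hd.nonempty.inl hr
    obtain ⟨L, hL1, hL2, hL3⟩ := exists_edb_list I har (↑(X ∪ Y) : Set V) ι ω hω
    let b : Atom (maxArity 𝔸 r) (Fin r) := ⟨Sum.inr ⟨⟨X.card, hXc⟩, relAlong τ Φ⟩, ι ∘ τ⟩
    let α : Rule (maxArity 𝔸 r) (Fin r) := ⟨⟨Sum.inr ⟨n, relAlong σ Ψ⟩, ι ∘ σ⟩, b :: L⟩
    have hbL : b ∉ L := fun hb => (hL2 b hb).1 rfl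
    have hb1 : ∀ f : Fin r → A, f ∘ b.args ∈ predRel 𝔸 r b.pred ↔ Φ (f ∘ ι) := fun f =>
      comp_mem_relAlong hd.determined hXτ (f ∘ ι)
    have hα1 : ∀ f : Fin r → A, f ∘ α.head.args ∈ predRel 𝔸 r α.head.pred ↔ Ψ (f ∘ ι) := fun f =>
      comp_mem_relAlong hΨ hXσ (f ∘ ι)
    have hα : IsMaxRule 𝔸 r α :=
      { head_idb := rfl
        linear := List.pairwise_cons.2 ⟨fun a ha h' => (hL2 a ha).1 h'.2,
          List.Pairwise.imp_of_mem (R := fun _ _ => True)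
          (fun {a b} ha _ _ h' => (hL2 a ha).1 h'.1) (List.pairwise_of_forall fun _ _ => trivial)⟩
        arity_le := by
          intro a ha
          rcases List.mem_cons.1 ha with rfl | ha
          · exact (Finset.mem_Icc.1 hXc).2
          · exact (hL2 a ha).2.1
        nodup := List.nodup_cons.2 ⟨hbL, hL1⟩
        consistent := fun f hf => (hα1 f).2 <|
          (h _ (hL3 f fun a ha => hf a (List.mem_cons_of_mem _ ha))).1
            ((hb1 f).1 (hf b List.mem_cons_self))
        mirror_consistent := by
          intro l₁ a l₂ hb ha f hf
          change b :: L = l₁ ++ a :: l₂ at hb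
          rcases l₁ with _ | ⟨b', l₁⟩
          · obtain ⟨rfl, rfl⟩ : b = a ∧ L = l₂ := by simpa using hb
            exact (hb1 f).2 <| (h _ (hL3 f fun a ha => hf a (List.mem_cons_of_mem _ ha))).2
              ((hα1 f).1 (hf _ List.mem_cons_self))
          · obtain ⟨-, rfl⟩ : b = b' ∧ L = l₁ ++ a :: l₂ := by simpa using hb
            exact absurd ha (hL2 a (by simp)).1 }
    have := Program.Derives.step (P := maxSymProgram 𝔸 r) (I := I) α hα ω (by
      intro a ha
      rcases List.mem_cons.1 ha with rfl | ha
      · have heq : b.map ω = ⟨Sum.inr ⟨⟨X.card, hXc⟩, relAlong τ Φ⟩, τ⟩ := by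
          simp only [b, Atom.map]
          congr 1
          funext t
          exact hω _ (Finset.mem_union_left _ (hτX t))
        exact hder.congr heq.symm
      · exact (hL2 a ha).2.2)
    have heq : α.head.map ω = ⟨Sum.inr ⟨n, relAlong σ Ψ⟩, σ⟩ := by
      simp only [α, Atom.map]
      congr 1
      funext t
      exact hω _ (Finset.mem_union_right _ (hσX t))
    exact this.congr heq

theorem SymDer.reachesGoal [Finite A] {I : 𝔸.Instance V} {r : ℕ} (har : ∀ R, 𝔸.arity R ≤ r)
    {X : Finset V} {Φ : (V → A) → Prop} (h : SymDer I r X Φ) (hΦ : ∀ f, ¬ Φ f) :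
    (maxSymProgram 𝔸 r).ReachesGoal I := by
  have hXc : X.card ∈ Finset.Icc 1 r :=
    Finset.mem_Icc.2 ⟨Finset.card_pos.2 h.nonempty, h.card_le⟩
  refine ⟨_, ?_, h.derives har ⟨X.card, hXc⟩ (fun i => X.equivFin.symm i)
    (fun i => (X.equivFin.symm i).2) (fun x hx => ⟨X.equivFin ⟨x, hx⟩, by simp⟩)⟩
  refine ⟨_, rfl, ?_⟩
  ext s
  simp [relAlong, hΦ]

end SymDer

/-! ## The maximal symmetric program is sound and symmetric -/

section Soundness

variable {A : Type u} {𝔸 : RelStructure.{u, v} A}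

theorem not_satisfiable_of_maxSymProgram_reachesGoal [Finite A] {V : Type*} {I : 𝔸.Instance V}
    {r : ℕ} (h : (maxSymProgram 𝔸 r).ReachesGoal I) : ¬ 𝔸.Satisfiable I := by
  rintro ⟨f, hf⟩
  have sound : ∀ a, (maxSymProgram 𝔸 r).Derives I a → f ∘ a.args ∈ predRel 𝔸 r a.pred := by
    intro a ha
    induction ha with
    | load c hc => exact hf c hc
    | step α hα ω _ ih => exact IsMaxRule.consistent hα (f ∘ ω) ih
  obtain ⟨⟨p, σ⟩, ⟨S, rfl, hS⟩, hder⟩ := h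
  have : f ∘ σ ∈ S.2 := sound _ hder
  rw [hS] at this
  exact this

theorem isRight_of_isIDB [Finite A] {r : ℕ} {S : 𝔸.Symb ⊕ RelAtMost A r}
    (h : (maxSymProgram 𝔸 r).IsIDB S) : S.isRight := by
  obtain ⟨α, hα, rfl⟩ := h
  exact IsMaxRule.head_idb hα

theorem not_isRight_of_pairwise {r : ℕ} {l₁ l₂ : List (Atom (maxArity 𝔸 r) (Fin r))}
    {a : Atom (maxArity 𝔸 r) (Fin r)}
    (h : (l₁ ++ a :: l₂).Pairwise fun a b => ¬ (a.pred.isRight ∧ b.pred.isRight))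
    (ha : a.pred.isRight) : ∀ b ∈ l₁ ++ l₂, ¬ b.pred.isRight := by
  rw [List.pairwise_append, List.pairwise_cons] at h
  obtain ⟨-, ⟨h1, -⟩, h2⟩ := h
  intro b hb hbr
  rcases List.mem_append.1 hb with hb | hb
  · exact h2 b hb a List.mem_cons_self ⟨hbr, ha⟩
  · exact h1 b hb ⟨ha, hbr⟩

theorem IsMaxRule.mirror {r : ℕ} {α : Rule (maxArity 𝔸 r) (Fin r)} (hα : IsMaxRule 𝔸 r α)
    {l₁ l₂ : List (Atom (maxArity 𝔸 r) (Fin r))} {a : Atom (maxArity 𝔸 r) (Fin r)}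
    (hb : α.body = l₁ ++ a :: l₂) (ha : a.pred.isRight) :
    IsMaxRule 𝔸 r (α.mirror l₁ a l₂) := by
  have hedb := not_isRight_of_pairwise (hb ▸ hα.linear) ha
  have hnd : (l₁ ++ l₂).Nodup :=
    (hb ▸ hα.nodup : (l₁ ++ a :: l₂).Nodup).sublist
      ((List.sublist_cons_self a l₂).append_left l₁)
  have hperm : (l₁ ++ α.head :: l₂).Perm (α.head :: (l₁ ++ l₂)) := List.perm_middle
  refine ⟨ha, ?_, ?_, ?_, hα.mirror_consistent _ _ _ hb ha, ?_⟩
  · refine (hperm.pairwise_iff fun {x y} h h' => h h'.symm).2 (List.pairwise_cons.2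
      ⟨fun b hb' h => hedb b hb' h.2, ?_⟩)
    exact List.Pairwise.imp_of_mem (R := fun _ _ => True)
      (fun {a b} ha _ _ h' => hedb a ha h'.1) (List.pairwise_of_forall fun _ _ => trivial)
  · intro b hb'
    rcases List.mem_cons.1 (hperm.mem_iff.1 hb') with rfl | hb'
    · have := hα.head_idb
      revert this
      rcases α.head.pred with R | S
      · simp
      · exact fun _ => (Finset.mem_Icc.1 S.1.2).2
    · refine hα.arity_le b ?_
      rw [hb]
      simp only [List.mem_append, List.mem_cons] at hb' ⊢
      tauto
  · exact hperm.nodup_iff.2 (List.nodup_cons.2 ⟨fun h => hedb _ h hα.head_idb, hnd⟩)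
  · intro l₁' b l₂' hb' hbr
    have hmem : b ∈ α.head :: (l₁ ++ l₂) :=
      hperm.mem_iff.1 (by rw [show l₁ ++ α.head :: l₂ = _ from hb']; simp)
    obtain rfl : b = α.head := by
      rcases List.mem_cons.1 hmem with h | h
      · exact h
      · exact absurd hbr (hedb _ h)
    intro f hf
    have hperm' : (l₁' ++ α.head :: l₂').Perm (α.head :: (l₁' ++ l₂')) := List.perm_middle
    have hrest : (l₁' ++ l₂').Perm (l₁ ++ l₂) := by
      refine (List.perm_cons α.head).1 (hperm'.symm.trans (List.Perm.trans ?_ hperm))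
      rw [show l₁ ++ α.head :: l₂ = _ from hb']
    refine hα.consistent f fun c hc => ?_
    rw [hb] at hc
    refine hf c ?_
    have : c ∈ a :: (l₁ ++ l₂) := List.perm_middle.mem_iff.1 hc
    refine List.perm_middle.mem_iff.2 ?_
    rcases List.mem_cons.1 this with rfl | h
    · exact List.mem_cons_self
    · exact List.mem_cons_of_mem _ (hrest.mem_iff.2 h)

theorem maxSymProgram_isSymmetric [Finite A] (𝔸 : RelStructure.{u, v} A) (r : ℕ) :
    (maxSymProgram 𝔸 r).IsSymmetric :=
  ⟨fun _ hα => (IsMaxRule.linear hα).imp fun h h' =>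
      h ⟨isRight_of_isIDB h'.1, isRight_of_isIDB h'.2⟩,
    fun _ hα _ _ _ hb ha => IsMaxRule.mirror hα hb (isRight_of_isIDB ha)⟩

end Soundness

/-! ## Hagemann–Mitschke operations and transitive relations -/

/-- The ternary operation `t` preserves the binary relation `e`. -/
def Preserves {Q : Type*} (t : Q → Q → Q → Q) (e : Q → Q → Prop) : Prop :=
  ∀ x x' y y' z z', e x x' → e y y' → e z z' → e (t x y z) (t x' y' z')

theorem symm_of_hagemannMitschke {Q : Type*} {n : ℕ} {p : Fin (n + 1) → Q → Q → Q → Q}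
    (h0 : ∀ x y z, p 0 x y z = x)
    (hp : ∀ (i : Fin n) x y, p i.castSucc x x y = p i.succ x y y)
    (hn : ∀ x y z, p (Fin.last n) x y z = z) {e : Q → Q → Prop} (he : ∀ i, Preserves (p i) e)
    (htrans : ∀ x y z, e x y → e y z → e x z) {x y : Q} (hx : e x x) (hy : e y y)
    (hxy : e x y) : e y x := by
  have key : ∀ i, e y (p i y y x) := by
    intro i
    induction i using Fin.induction with
    | zero => rwa [h0]
    | succ i ih =>
      rw [hp] at ih
      exact htrans _ _ _ ih (he _ _ _ _ _ _ _ hy hxy hx)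
  simpa [hn] using key (Fin.last n)

theorem chain_trans {Q : Type*} {e : Q → Q → Prop} (htrans : ∀ x y z, e x y → e y z → e x z)
    {z : ℕ → Q} {s : ℕ} (hz : ∀ a < s, e (z a) (z (a + 1))) {a b : ℕ} (hab : a < b)
    (hb : b ≤ s) : e (z a) (z b) := by
  induction b, hab using Nat.le_induction with
  | base => exact hz a (by omega)
  | succ b _ ih => exact htrans _ _ _ (ih (by omega)) (hz b (by omega))

theorem exists_refl_of_chain {Q : Type*} [Finite Q] {e : Q → Q → Prop}
    (htrans : ∀ x y z, e x y → e y z → e x z) {z : ℕ → Q}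
    (hz : ∀ a < Nat.card Q, e (z a) (z (a + 1))) : ∃ a ≤ Nat.card Q, e (z a) (z a) := by
  have := Fintype.ofFinite Q
  obtain ⟨a, b, hne, hab⟩ := Fintype.exists_ne_map_eq_of_card_lt
    (fun a : Fin (Nat.card Q + 1) => z a) (by simp [Nat.card_eq_fintype_card])
  wlog hlt : a < b generalizing a b
  · exact this b a hne.symm hab.symm (lt_of_le_of_ne (not_lt.1 hlt) hne.symm)
  refine ⟨a, by omega, ?_⟩
  have h := chain_trans htrans hz (show (a : ℕ) < b from hlt) (by omega)
  rwa [← hab] at h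

/-! ## Concatenating many blocks carrying the same transitive relation -/

section Idempotent

variable {A : Type u} {𝔸 : RelStructure.{u, v} A} {V : Type*} [DecidableEq V]

theorem SymDer.trans_chain {I : 𝔸.Instance V} {Q : Type*} [Finite Q] {e : Q → Q → Prop}
    (htrans : ∀ x y z, e x y → e y z → e x z)
    (hsymm : ∀ x y, e x x → e y y → e x y → e y x)
    {K d t : ℕ} {X : ℕ → Finset V} (hX : ∀ a, (X a).Nonempty) (hK : ∀ a, (X a).card ≤ K)
    {y : ℕ → (V → A) → Q} (hy : ∀ a f g, (∀ x ∈ X a, f x = g x) → y a f = y a g)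
    (ht : 0 < t)
    (hd : ∀ a < t, SymDer I d (X a ∪ X (a + 1)) (fun f => e (y a f) (y (a + 1) f))) :
    SymDer I ((2 * Nat.card Q + 3) * d + (Nat.card Q + 5) * K) (X 0 ∪ X t)
      (fun f => e (y 0 f) (y t f)) := by
  set N := Nat.card Q with hN
  have hdet : Determined (X 0 ∪ X t) (fun f => e (y 0 f) (y t f)) := by
    intro f g hfg h
    rwa [← hy 0 f g fun x hx => hfg x (Finset.mem_union_left _ hx),
      ← hy t f g fun x hx => hfg x (Finset.mem_union_right _ hx)]
  have hcard2 : ∀ a b, (X a ∪ X b).card ≤ 2 * K := fun a b =>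
    (Finset.card_union_le _ _).trans (by have := hK a; have := hK b; omega)
  rcases Nat.lt_or_ge N t with hNt | hNt
  swap
  · refine (SymDer.forall_lt ht hd).of_imp (hX 0).inl ?_ hdet
      fun f hf => chain_trans htrans (z := fun a => y a f) hf ht le_rfl
    have := hcard2 0 t
    nlinarith [Nat.zero_le (N * d), Nat.zero_le (N * K), Nat.mul_le_mul_right d hNt]
  let W : ℕ → Finset V := fun j => (Finset.range (N + 1)).biUnion fun a => X (j + a)
  let Φ : ℕ → (V → A) → Prop := fun j f =>
    ∃ a ≤ N, e (y (j + a) f) (y (j + a) f) ∧ e (y 0 f) (y (j + a) f)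
  have hmemW : ∀ j a, a ≤ N → X (j + a) ⊆ X 0 ∪ W j := fun j a ha =>
    (Finset.subset_biUnion_of_mem (fun a => X (j + a)) (Finset.mem_range.2 (by omega))).trans
      Finset.subset_union_right
  have hΦdet : ∀ j, Determined (X 0 ∪ W j) (Φ j) := by
    rintro j f g hfg ⟨a, ha, h1, h2⟩
    rw [hy 0 f g fun x hx => hfg x (Finset.mem_union_left _ hx)] at h2
    rw [hy (j + a) f g fun x hx => hfg x (hmemW j a ha hx)] at h1 h2
    exact ⟨a, ha, h1, h2⟩
  have hcardW : ∀ j, ((X 0 ∪ W j) ∪ (X 0 ∪ W (j + 1))).card ≤ (N + 3) * K := by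
    intro j
    have hsub : (X 0 ∪ W j) ∪ (X 0 ∪ W (j + 1)) ⊆
        X 0 ∪ (Finset.range (N + 2)).biUnion fun a => X (j + a) := by
      intro x hx
      simp only [W, Finset.mem_union, Finset.mem_biUnion, Finset.mem_range] at hx ⊢
      rcases hx with (h | ⟨a, ha, h⟩) | h | ⟨a, ha, h⟩
      · exact Or.inl h
      · exact Or.inr ⟨a, by omega, h⟩
      · exact Or.inl h
      · exact Or.inr ⟨a + 1, by omega, by rwa [← add_assoc, add_right_comm]⟩
    refine (Finset.card_le_card hsub).trans ((Finset.card_union_le _ _).trans ?_)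
    have h1 := Finset.card_biUnion_le_card_mul (Finset.range (N + 2)) (fun a => X (j + a)) K
      fun a _ => hK _
    rw [Finset.card_range] at h1
    have := hK 0
    nlinarith
  have hfacts : ∀ j, j + N + 1 ≤ t → SymDer I ((N + 1) * d)
      ((Finset.range (N + 1)).biUnion fun a => X (j + a) ∪ X (j + a + 1))
      (fun f => ∀ a < N + 1, e (y (j + a) f) (y (j + a + 1) f)) := fun j hj =>
    SymDer.forall_lt (by omega) fun a ha => hd (j + a) (by omega)
  have hstate : ∀ j, j + N + 1 ≤ t →
      SymDer I ((N + 1) * d + (N + 3) * K) (X 0 ∪ W j) (Φ j) := by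
    intro j
    induction j with
    | zero =>
      intro hj
      refine (hfacts 0 hj).of_imp (hX 0).inl ?_ (hΦdet 0) fun f hf => ?_
      · have := (Finset.card_le_card (Finset.subset_union_left (s₁ := X 0 ∪ W 0)
          (s₂ := X 0 ∪ W (0 + 1)))).trans (hcardW 0)
        omega
      · have hf' : ∀ a < N + 1, e (y a f) (y (a + 1) f) := by simpa using hf
        obtain ⟨a, ha, hea⟩ := exists_refl_of_chain htrans (z := fun a => y a f)
          fun a ha => hf' a (by omega)
        refine ⟨a, ha, by simpa using hea, ?_⟩
        rw [zero_add]
        rcases Nat.eq_zero_or_pos a with rfl | h0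
        · exact hea
        · exact chain_trans htrans (z := fun a => y a f) hf' h0 (by omega)
    | succ j ih =>
      intro hj
      refine (hfacts j (by omega)).step_of (ih (by omega)) (hX 0).inl ?_ (hΦdet _) fun f hf => ?_
      · have := hcardW j
        omega
      · let z : ℕ → Q := fun a => y (j + a) f
        have hz : ∀ a < N + 1, e (z a) (z (a + 1)) := hf
        have hmove : ∀ a b, a ≤ N + 1 → b ≤ N + 1 → e (z a) (z a) → e (z b) (z b) →
            e (z a) (z b) := by
          intro a b ha hb hea heb
          rcases lt_trichotomy a b with h | rfl | h
          · exact chain_trans htrans hz h hb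
          · exact hea
          · exact hsymm _ _ heb hea (chain_trans htrans hz h ha)
        constructor
        · rintro ⟨a, ha, h1, h2⟩
          obtain ⟨b, hb, heb⟩ := exists_refl_of_chain htrans (z := fun a => z (a + 1))
            fun a ha => hz (a + 1) (by omega)
          have heq : y (j + 1 + b) f = z (b + 1) := by
            simp only [z]; rw [add_assoc, add_comm 1 b]
          refine ⟨b, hb, by rw [heq]; exact heb, ?_⟩
          rw [heq]
          exact htrans _ _ _ h2 (hmove a (b + 1) (by omega) (by omega) h1 heb)
        · rintro ⟨b, hb, h1, h2⟩
          obtain ⟨a, ha, hea⟩ := exists_refl_of_chain htrans (z := z)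
            fun a ha => hz a (by omega)
          have heq : y (j + 1 + b) f = z (b + 1) := by
            simp only [z]; rw [add_assoc, add_comm 1 b]
          rw [heq] at h1 h2
          exact ⟨a, ha, hea, htrans _ _ _ h2 (hmove (b + 1) a (by omega) (by omega) h1 hea)⟩
  obtain ⟨j, rfl⟩ : ∃ j, t = j + N + 1 := ⟨t - N - 1, by omega⟩
  refine ((hstate j le_rfl).and (hfacts j le_rfl)).of_imp (hX 0).inl ?_ hdet ?_
  · have := hcard2 0 (j + N + 1)
    nlinarith
  · rintro f ⟨⟨a, ha, -, h2⟩, hf⟩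
    exact htrans _ _ _ h2 (chain_trans htrans (z := fun a => y (j + a) f) hf
      (show a < N + 1 by omega) le_rfl)

end Idempotent

/-! ## Chains of binary relations -/

/-- Binary relations on `Q`, viewed as a monoid under composition. -/
def BinRel (Q : Type*) : Type _ := Q → Q → Prop

instance (Q : Type*) : Monoid (BinRel Q) where
  mul r s := Relation.Comp r s
  one := Eq
  mul_assoc r s t := Relation.comp_assoc
  one_mul r := Relation.eq_comp
  mul_one r := Relation.comp_eq

instance (Q : Type*) [Finite Q] : Finite (BinRel Q) :=
  inferInstanceAs (Finite (Q → Q → Prop))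

/-- `x` and `y` are the ends of a chain that leads from layer `i` to layer `j`. -/
def ChainRel {Q : Type*} (E : ℕ → Q → Q → Prop) (i j : ℕ) : BinRel Q := fun x y =>
  ∃ g : ℕ → Q, g i = x ∧ g j = y ∧ ∀ l, i ≤ l → l < j → E l (g l) (g (l + 1))

theorem chainRel_mul {Q : Type*} (E : ℕ → Q → Q → Prop) (i j k : ℕ) (hij : i < j)
    (hjk : j < k) : ChainRel E i j * ChainRel E j k = ChainRel E i k := by
  funext x z
  apply propext
  constructor
  · rintro ⟨y, ⟨g, rfl, rfl, hg⟩, ⟨g', hy, rfl, hg'⟩⟩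
    refine ⟨fun l => if l ≤ j then g l else g' l, by simp [hij.le], by simp [hjk], ?_⟩
    intro l hl hlk
    rcases lt_trichotomy l j with h | rfl | h
    · simpa [h.le, Nat.succ_le_of_lt h] using hg l hl h
    · simpa [← hy] using hg' l le_rfl hlk
    · simpa [not_le.2 h, show ¬ l + 1 ≤ j by omega] using hg' l h.le hlk
  · rintro ⟨g, rfl, rfl, hg⟩
    exact ⟨g j, ⟨g, rfl, rfl, fun l h h' => hg l h (h'.trans hjk)⟩,
      ⟨g, rfl, rfl, fun l h h' => hg l (hij.le.trans h) h'⟩⟩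

theorem chainRel_succ {Q : Type*} (E : ℕ → Q → Q → Prop) (i : ℕ) {x y : Q} (h : E i x y) :
    ChainRel E i (i + 1) x y := by
  refine ⟨fun l => if l = i then x else y, by simp, by simp, fun l hl hl' => ?_⟩
  obtain rfl : l = i := by omega
  simpa using h

theorem Preserves.chainRel {Q : Type*} {t : Q → Q → Q → Q} {E : ℕ → Q → Q → Prop}
    (h : ∀ l, Preserves t (E l)) (i j : ℕ) : Preserves t (ChainRel E i j) := by
  rintro _ _ _ _ _ _ ⟨g, rfl, rfl, hg⟩ ⟨g', rfl, rfl, hg'⟩ ⟨g'', rfl, rfl, hg''⟩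
  exact ⟨fun l => t (g l) (g' l) (g'' l), rfl, rfl, fun l hl hl' =>
    h l _ _ _ _ _ _ (hg l hl hl') (hg' l hl hl') (hg'' l hl hl')⟩

/-! ## Refuting path instances -/

section Path

variable {A : Type u} {𝔸 : RelStructure.{u, v} A} {V : Type*}

/-- The pairs of values that local solutions of `I` take on two consecutive bags of a sequence of
bags of variables, the bags being given by tuples. -/
def BagRel (I : 𝔸.Instance V) {K : ℕ} (τ : ℕ → Fin K → V) (i : ℕ) (x y : Fin K → A) : Prop :=
  ∃ f, LocalSol I (Set.range (τ i) ∪ Set.range (τ (i + 1))) f ∧ f ∘ τ i = x ∧ f ∘ τ (i + 1) = y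

/-- No sequence of values on the bags `τ 0, …, τ m` is consistent with the local solutions. -/
def PathRefuted (I : 𝔸.Instance V) {K : ℕ} (τ : ℕ → Fin K → V) (m : ℕ) : Prop :=
  ∀ g : ℕ → Fin K → A, ¬ ∀ i < m, BagRel I τ i (g i) (g (i + 1))

theorem preserves_bagRel {I : 𝔸.Instance V} {K : ℕ} {τ : ℕ → Fin K → V}
    {t : (Fin 3 → A) → A} (ht : 𝔸.IsPolymorphism t) (l : ℕ) :
    Preserves (fun (x y z : Fin K → A) k => t ![x k, y k, z k]) (BagRel I τ l) := by
  rintro _ _ _ _ _ _ ⟨f, hf, rfl, rfl⟩ ⟨f', hf', rfl, rfl⟩ ⟨f'', hf'', rfl, rfl⟩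
  refine ⟨fun v => t ![f v, f' v, f'' v], ?_, rfl, rfl⟩
  intro c hc hcs
  have := ht c.pred ![f ∘ c.args, f' ∘ c.args, f'' ∘ c.args] (by
    intro i
    fin_cases i
    · exact hf c hc hcs
    · exact hf' c hc hcs
    · exact hf'' c hc hcs)
  convert this using 2 with j
  simp only [Function.comp]
  congr 1
  funext i
  fin_cases i <;> rfl

/-- A bound on the number of variables of the symmetric derivations for factorization forests of
height `d`. -/
def forestWidth (N K : ℕ) : ℕ → ℕ
  | 0 => 2 * K
  | d + 1 => (2 * N + 3) * forestWidth N K d + (N + 5) * K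

theorem exists_symDer_of_pathRefuted [Finite A] {n : ℕ} (hHM : 𝔸.HasHagemannMitschke n) {K : ℕ}
    (hK : 0 < K) :
    ∃ r, ∀ (V : Type) [DecidableEq V] (I : 𝔸.Instance V) (τ : ℕ → Fin K → V) (m : ℕ), 0 < m →
      PathRefuted I τ m →
      ∃ (X : Finset V) (Φ : (V → A) → Prop), SymDer I r X Φ ∧ ∀ f, ¬ Φ f := by
  obtain ⟨p, hpol, hp0, hps, hpn⟩ := hHM
  obtain ⟨h, hh⟩ := exists_forest_height (BinRel (Fin K → A))
  refine ⟨forestWidth (Nat.card (Fin K → A)) K h, fun V _ I τ m hm href => ?_⟩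
  let X : ℕ → Finset V := fun i => Finset.univ.image (τ i)
  have hXne : ∀ i, (X i).Nonempty := fun i =>
    ⟨τ i ⟨0, hK⟩, Finset.mem_image_of_mem _ (Finset.mem_univ _)⟩
  have hXK : ∀ i, (X i).card ≤ K := fun i =>
    Finset.card_image_le.trans (by simp)
  have hX2 : ∀ i j, (X i ∪ X j).card ≤ 2 * K := fun i j =>
    (Finset.card_union_le _ _).trans (by have := hXK i; have := hXK j; omega)
  have hval : ∀ i (f g : V → A), (∀ x ∈ X i, f x = g x) → f ∘ τ i = g ∘ τ i := fun i f g hfg =>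
    funext fun k => hfg _ (Finset.mem_image_of_mem _ (Finset.mem_univ _))
  let σ : ℕ → ℕ → BinRel (Fin K → A) := ChainRel (BagRel I τ)
  let Φ : ℕ → ℕ → (V → A) → Prop := fun i j f => σ i j (f ∘ τ i) (f ∘ τ j)
  have hdet : ∀ i j, Determined (X i ∪ X j) (Φ i j) := by
    intro i j f g hfg hf
    simp only [Φ] at hf ⊢
    rwa [← hval i f g fun x hx => hfg x (Finset.mem_union_left _ hx),
      ← hval j f g fun x hx => hfg x (Finset.mem_union_right _ hx)]
  set N := Nat.card (Fin K → A) with hN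
  let G : ℕ → ℕ → ℕ → Prop := fun d i j => SymDer I (forestWidth N K d) (X i ∪ X j) (Φ i j)
  have hG : ForestClosed σ G :=
    { base := by
        intro i
        refine .start _ _ (hXne i).inl (hX2 _ _) (hdet _ _) fun f hf => ?_
        refine chainRel_succ _ _ ⟨f, hf.anti ?_, rfl, rfl⟩
        simp [X]
      mul := chainRel_mul _
      mono := by
        intro d i j hd
        refine hd.mono ?_
        simp only [forestWidth]
        nlinarith [Nat.zero_le (N * forestWidth N K d)]
      binary := by
        intro d i j k hij hjk h1 h2
        refine (h1.and h2).of_imp (hXne i).inl ?_ (hdet i k) ?_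
        · have := hX2 i k
          simp only [forestWidth]
          nlinarith [Nat.zero_le (N * forestWidth N K d), Nat.zero_le (N * K)]
        · rintro f ⟨hf1, hf2⟩
          change σ i k _ _
          simp only [σ]
          rw [← chainRel_mul _ i j k hij hjk]
          exact ⟨_, hf1, hf2⟩
      idem := by
        intro d e t pos hee ht hpos
        have hσe : ∀ a < t, σ (pos a) (pos (a + 1)) = e := fun a ha => (hpos a ha).2.1
        have htrans : ∀ x y z, e x y → e y z → e x z := by
          intro x y z hxy hyz
          rw [← hee]
          exact ⟨y, hxy, hyz⟩
        have hpres : ∀ i, Preserves (fun (x y z : Fin K → A) k => p i ![x k, y k, z k]) e := by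
          intro i
          rw [← hσe 0 ht]
          exact Preserves.chainRel (fun l => preserves_bagRel (hpol i) l) _ _
        have hsymm : ∀ x y, e x x → e y y → e x y → e y x := fun x y hx hy hxy =>
          symm_of_hagemannMitschke (p := fun i (x y z : Fin K → A) k => p i ![x k, y k, z k])
            (fun x y z => funext fun k => hp0 _ _ _)
            (fun i x y => funext fun k => hps i _ _)
            (fun x y z => funext fun k => hpn _ _ _) hpres htrans hx hy hxy
        have main := SymDer.trans_chain (I := I) htrans hsymm (d := forestWidth N K d) (t := t)
          (X := fun a => X (pos a)) (fun a => hXne _) (fun a => hXK _)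
          (y := fun a f => f ∘ τ (pos a)) (fun a f g => hval _ f g) ht (by
            intro a ha
            have := (hpos a ha).2.2
            simp only [G, Φ, hσe a ha] at this
            exact this)
        have hlt : ∀ {s}, 0 < s → s ≤ t → pos 0 < pos s := fun h h' =>
          lt_of_lt_step (fun a ha => (hpos a ha).1) h h'
        have hprod : ∀ s, 1 ≤ s → s ≤ t → σ (pos 0) (pos s) = e := by
          intro s hs
          induction s, hs using Nat.le_induction with
          | base => exact fun _ => hσe 0 ht
          | succ s hs ih =>
            intro hst
            have h1 := chainRel_mul (BagRel I τ) (pos 0) (pos s) (pos (s + 1))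
              (hlt hs (by omega)) (hpos s (by omega)).1
            change σ _ _ * σ _ _ = σ _ _ at h1
            rw [← h1, ih (by omega), hσe s (by omega), hee]
        simp only [G, Φ, hprod t ht le_rfl]
        exact main }
  refine ⟨_, _, hh σ G hG 0 m hm, ?_⟩
  rintro f ⟨g, -, -, hg⟩
  exact href g fun i hi => hg i (Nat.zero_le i) hi

end Path

/-! ## Path instances from bounded pathwidth duality -/

section Obstructions

variable {A : Type u} {𝔸 : RelStructure.{u, v} A}

theorem satisfiable_of_isEmpty {V : Type*} [IsEmpty V] (I : 𝔸.Instance V) :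
    𝔸.Satisfiable I :=
  ⟨isEmptyElim, fun c _ => isEmptyElim (c.args ⟨0, 𝔸.arity_pos _⟩)⟩

theorem exists_tuple_of_card_le {W : Type*} [Nonempty W] (s : Finset W) {K : ℕ}
    (hs : s.card ≤ K) : ∃ e : Fin K → W, ∀ w ∈ s, ∃ k, e k = w := by
  classical
  obtain ⟨w0⟩ := ‹Nonempty W›
  refine ⟨fun k => if h : (k : ℕ) < s.card then (s.equivFin.symm ⟨k, h⟩ : s) else w0, ?_⟩
  intro w hw
  exact ⟨Fin.castLE hs (s.equivFin ⟨w, hw⟩), by simp⟩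

theorem pathRefuted_of_pathwidth {V W : Type*} {I : 𝔸.Instance V} {J : 𝔸.Instance W} {k : ℕ}
    (hJ : ¬ 𝔸.Satisfiable J) (hpw : 𝔸.PathwidthAtMost J k) (h : W → V)
    (hh : ∀ c ∈ J, c.map h ∈ I) :
    ∃ (τ : ℕ → Fin (k + 1) → V) (m : ℕ), 0 < m ∧ PathRefuted I τ m := by
  have hW : Nonempty W := by
    by_contra hne
    rw [not_nonempty_iff] at hne
    exact hJ (satisfiable_of_isEmpty J)
  obtain ⟨m, U, hcov, hcard, hconn, hscope⟩ := hpw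
  obtain ⟨w0⟩ := id hW
  have hm : 0 < m := by
    obtain ⟨i, -⟩ := hcov w0
    exact i.pos
  choose e he using fun i => exists_tuple_of_card_le (U i) (hcard i)
  let τ : ℕ → Fin (k + 1) → V := fun i => h ∘ e ⟨min i (m - 1), by omega⟩
  have hτ : ∀ i : Fin m, τ i = h ∘ e i := fun i => by
    simp only [τ]
    congr 2
    exact Fin.ext (by simp; omega)
  refine ⟨τ, m, hm, fun g hg => hJ ?_⟩
  choose f hf hf1 hf2 using fun i : Fin m => hg i i.2
  have hval : ∀ (i : Fin m) k, f i (h (e i k)) = g i k := fun i k => by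
    rw [← hf1 i, hτ i]; rfl
  have hagree : ∀ (i : Fin m) (l : ℕ) (hl : l < m), (i : ℕ) ≤ l → ∀ w, w ∈ U i → w ∈ U ⟨l, hl⟩ →
      f i (h w) = f ⟨l, hl⟩ (h w) := by
    intro i l hl hil w hwi
    induction l, hil using Nat.le_induction with
    | base => exact fun _ => rfl
    | succ l hil ih =>
      intro hwl
      have hwl' : w ∈ U ⟨l, by omega⟩ := by
        rcases hil.eq_or_lt with heq | hlt
        · have : i = ⟨l, by omega⟩ := Fin.ext heq
          exact this ▸ hwi
        · exact hconn i ⟨l, by omega⟩ ⟨l + 1, hl⟩ hlt (Nat.lt_succ_self l) w hwi hwl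
      rw [ih (by omega) hwl']
      obtain ⟨k, rfl⟩ := he ⟨l + 1, hl⟩ w hwl
      rw [hval ⟨l + 1, hl⟩ k]
      have := congrFun (hf2 ⟨l, by omega⟩) k
      rw [← this]
      change _ = f _ (τ (l + 1) k)
      rw [hτ ⟨l + 1, hl⟩]
      rfl
  have hagree' : ∀ (i l : Fin m) w, w ∈ U i → w ∈ U l → f i (h w) = f l (h w) := by
    intro i l w hi hl
    rcases le_total (i : ℕ) l with hil | hil
    · exact hagree i l l.2 hil w hi hl
    · exact (hagree l i i.2 hil w hl hi).symm
  choose bag hbag using hcov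
  refine ⟨fun w => f (bag w) (h w), fun c hc => ?_⟩
  obtain ⟨i, hi⟩ := hscope c hc
  have := hf i (c.map h) (hh c hc) fun t => Or.inl (by
    obtain ⟨k, hk⟩ := he i (c.args t) (hi t)
    exact ⟨k, by rw [hτ i]; exact congrArg h hk⟩)
  have heq : (fun w => f (bag w) (h w)) ∘ c.args = f i ∘ (c.map h).args :=
    funext fun t => hagree' _ _ _ (hbag _) (hi t)
  rw [heq]
  exact this

/-! ## Path instances from linear Datalog programs -/

theorem Program.Derives.exists_edb {P : Program 𝔸} {V : Type*} {I : 𝔸.Instance V}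
    {a : Atom P.arity V} (h : P.Derives I a) (ha : ¬ P.IsIDB a.pred) :
    ∃ c ∈ I, a = ⟨Sum.inl c.pred, c.args⟩ := by
  cases h with
  | load c hc => exact ⟨c, hc, rfl⟩
  | step α hα ω hb => exact absurd ⟨α, hα, rfl⟩ ha

/-- The structure itself, viewed as an instance and transported along `ε`. -/
def selfInstance (𝔸 : RelStructure.{u, v} A) {B : Type*} (ε : A ≃ B) : 𝔸.Instance B :=
  {c | ε.symm ∘ c.args ∈ 𝔸.rel c.pred}

theorem satisfiable_selfInstance {B : Type*} (ε : A ≃ B) :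
    𝔸.Satisfiable (selfInstance 𝔸 ε) :=
  ⟨ε.symm, fun _ hc => hc⟩

theorem derives_selfInstance_of_edb {P : Program 𝔸} {V B : Type*} {I : 𝔸.Instance V}
    (ε : A ≃ B) {a : Atom P.arity V} {Z : Set V} {f : V → A} (hf : LocalSol I Z f)
    (haZ : ∀ t, a.args t ∈ Z) (ha : ∃ c ∈ I, a = ⟨Sum.inl c.pred, c.args⟩) :
    P.Derives (selfInstance 𝔸 ε) (a.map (ε ∘ f)) := by
  obtain ⟨c, hc, rfl⟩ := ha
  refine Program.Derives.load (P := P) ⟨c.pred, (ε ∘ f) ∘ c.args⟩ ?_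
  have := hf c hc haZ
  simpa [selfInstance, Function.comp_def] using this

theorem exists_extend_tuple {V : Type*} [Nonempty V] {n K : ℕ} (h : n ≤ K) (σ : Fin n → V) :
    ∃ τ : Fin K → V, τ ∘ Fin.castLE h = σ := by
  obtain ⟨v0⟩ := ‹Nonempty V›
  refine ⟨fun k => if h : (k : ℕ) < n then σ ⟨k, h⟩ else v0, ?_⟩
  funext i
  simp

/-- A linear derivation unfolds to a path instance: every assignment to its bags that is
consistent with the local solutions turns the derivation into one over `𝔸` itself. -/
theorem Program.Derives.exists_path {P : Program 𝔸} (hlin : P.IsLinear) {K : ℕ}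
    (hvars : P.numVars ≤ K) (har : ∀ R, 𝔸.arity R ≤ K) {V B : Type*} {I : 𝔸.Instance V}
    (ε : A ≃ B) {a : Atom P.arity V} (h : P.Derives I a) :
    ∃ (τ : ℕ → Fin K → V) (m : ℕ) (a' : Atom P.arity (Fin K)), 0 < m ∧ a = a'.map (τ m) ∧
      ∀ g : ℕ → Fin K → A, (∀ i < m, BagRel I τ i (g i) (g (i + 1))) →
        P.Derives (selfInstance 𝔸 ε) (a'.map (ε ∘ g m)) := by
  induction h with
  | load c hc =>
    have : Nonempty V := ⟨c.args ⟨0, 𝔸.arity_pos _⟩⟩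
    obtain ⟨T, hT⟩ := exists_extend_tuple (har c.pred) c.args
    have heq : (⟨Sum.inl c.pred, c.args⟩ : Atom P.arity V) =
        (⟨Sum.inl c.pred, Fin.castLE (har c.pred)⟩ : Atom P.arity (Fin K)).map T := by
      simp only [Atom.map]
      congr 1
      exact hT.symm
    refine ⟨fun _ => T, 1, _, one_pos, heq, fun g hg => ?_⟩
    obtain ⟨f, hf, -, hf2⟩ := hg 0 one_pos
    have hsc : ∀ t, c.args t ∈ Set.range T ∪ Set.range T := fun t =>
      Or.inl ⟨Fin.castLE (har c.pred) t, congrFun hT t⟩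
    have := derives_selfInstance_of_edb (P := P) ε hf
      (a := ⟨Sum.inl c.pred, c.args⟩) hsc ⟨c, hc, rfl⟩
    rw [heq] at this
    rw [← hf2]
    exact this
  | step α hα ω hb ih =>
    have hpos : ∀ p, 0 < P.arity p := by
      rintro (R | S)
      · exact 𝔸.arity_pos R
      · exact P.auxArity_pos S
    have : Nonempty V := ⟨ω (α.head.args ⟨0, hpos _⟩)⟩
    obtain ⟨T, hT⟩ := exists_extend_tuple hvars ω
    have hhead : α.head.map ω = (α.head.map (Fin.castLE hvars)).map T := by
      rw [← hT]; rfl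
    have hωT : ∀ t, ω t ∈ Set.range T := fun t => ⟨Fin.castLE hvars t, congrFun hT t⟩
    have hedb : ∀ {c : Atom P.arity (Fin P.numVars)} {Z : Set V} {f : V → A}, c ∈ α.body →
        ¬ P.IsIDB c.pred → LocalSol I (Z ∪ Set.range T) f →
        P.Derives (selfInstance 𝔸 ε) (c.map (ε ∘ f ∘ ω)) := fun {c} _ _ hc hnot hf =>
      derives_selfInstance_of_edb (a := c.map ω) ε hf (fun t => Or.inr (hωT _)) ((hb _ hc).exists_edb hnot)
    have hfin : ∀ {f : V → A}, P.Derives (selfInstance 𝔸 ε) (α.head.map (ε ∘ f ∘ ω)) →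
        P.Derives (selfInstance 𝔸 ε) ((α.head.map (Fin.castLE hvars)).map (ε ∘ f ∘ T)) := by
      intro f hd
      rw [← hT] at hd
      exact hd
    by_cases hex : ∃ b ∈ α.body, P.IsIDB b.pred
    · obtain ⟨b, hbm, hbI⟩ := hex
      obtain ⟨τ, m, b', hm, hbeq, hder⟩ := ih b hbm
      refine ⟨fun i => if i ≤ m then τ i else T, m + 1, α.head.map (Fin.castLE hvars),
        Nat.succ_pos m, by simpa using hhead, fun g hg => ?_⟩
      have hb' := hder g fun i hi => by
        have := hg i (by omega)
        simpa only [BagRel, if_pos hi.le, if_pos (Nat.succ_le_of_lt hi)] using this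
      obtain ⟨f, hf, hf1, hf2⟩ := hg m (Nat.lt_succ_self m)
      simp only [le_refl, if_true, show ¬ m + 1 ≤ m by omega, if_false] at hf hf1 hf2
      rw [← hf2]
      refine hfin (.step α hα (ε ∘ f ∘ ω) fun c hc => ?_)
      by_cases hcb : c = b
      · have : c.map (ε ∘ f ∘ ω) = b'.map (ε ∘ g m) := by
          rw [hcb, ← hf1]
          exact congrArg (Atom.map (ε ∘ f)) hbeq
        rw [this]
        exact hb'
      · refine hedb hc (fun hcI => ?_) hf
        have : Std.Symm fun a b : Atom P.arity (Fin P.numVars) =>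
            ¬ (P.IsIDB a.pred ∧ P.IsIDB b.pred) := ⟨fun _ _ h h' => h h'.symm⟩
        exact (hlin α hα).forall hc hbm hcb ⟨hcI, hbI⟩
    · refine ⟨fun _ => T, 1, α.head.map (Fin.castLE hvars), one_pos, hhead, fun g hg => ?_⟩
      obtain ⟨f, hf, -, hf2⟩ := hg 0 one_pos
      rw [← hf2]
      exact hfin (.step α hα (ε ∘ f ∘ ω) fun c hc => hedb hc (fun hcI => hex ⟨c, hc, hcI⟩) hf)

theorem exists_arity_bound (𝔸 : RelStructure.{u, v} A) : ∃ k, ∀ R, 𝔸.arity R ≤ k := by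
  have := 𝔸.finite_symb
  obtain ⟨k, hk⟩ := (Set.finite_range 𝔸.arity).bddAbove
  exact ⟨k, fun R => hk ⟨R, rfl⟩⟩

theorem exists_path_obstructions [Finite A]
    (hlin : (∃ P : Program 𝔸, P.IsLinear ∧ P.Decides) ∨ 𝔸.HasBoundedPathwidthDuality) :
    ∃ K, 0 < K ∧ ∀ (V : Type) [Finite V] (I : 𝔸.Instance V), ¬ 𝔸.Satisfiable I →
      ∃ (τ : ℕ → Fin K → V) (m : ℕ), 0 < m ∧ PathRefuted I τ m := by
  rcases hlin with ⟨P, hP, hdec⟩ | ⟨k, hk⟩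
  · obtain ⟨k, hk⟩ := exists_arity_bound 𝔸
    refine ⟨P.numVars + k + 1, by omega, fun V _ I hI => ?_⟩
    obtain ⟨a, hgoal, hder⟩ := (hdec V I).2 hI
    have ε : A ≃ Fin (Nat.card A) := Finite.equivFin A
    obtain ⟨τ, m, a', hm, rfl, hpath⟩ := hder.exists_path hP (K := P.numVars + k + 1) (by omega)
      (fun R => (hk R).trans (by omega)) ε
    exact ⟨τ, m, hm, fun g hg => (hdec _ (selfInstance 𝔸 ε)).1 ⟨_, hgoal, hpath g hg⟩
      (satisfiable_selfInstance ε)⟩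
  · refine ⟨k + 1, by omega, fun V _ I hI => ?_⟩
    obtain ⟨W, _, J, hJ, hpw, h, hh⟩ := hk V I hI
    exact pathRefuted_of_pathwidth hJ hpw h hh

end Obstructions

theorem exists_maxSymProgram_decides {A : Type u} [Finite A] (𝔸 : RelStructure.{u, v} A)
    (hlin : (∃ P : Program 𝔸, P.IsLinear ∧ P.Decides) ∨ 𝔸.HasBoundedPathwidthDuality)
    {n : ℕ} (hHM : 𝔸.HasHagemannMitschke n) :
    ∃ r : ℕ, 1 ≤ r ∧ (maxSymProgram 𝔸 r).Decides := by
  classical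
  obtain ⟨K, hK, hpath⟩ := exists_path_obstructions hlin
  obtain ⟨r, hr⟩ := exists_symDer_of_pathRefuted hHM hK
  obtain ⟨k, hk⟩ := exists_arity_bound 𝔸
  refine ⟨r + k + 1, by omega, fun V _ I =>
    ⟨not_satisfiable_of_maxSymProgram_reachesGoal, fun hI => ?_⟩⟩
  obtain ⟨τ, m, hm, href⟩ := hpath V I hI
  obtain ⟨X, Φ, hder, hΦ⟩ := hr V I τ m hm href
  exact (hder.mono (by omega)).reachesGoal (fun R => (hk R).trans (by omega)) hΦ

end SymDatalog

open SymDatalog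
theorem theorem1 {A : Type u} [Finite A] (𝔸 : RelStructure.{u, v} A)
    (hlin : (∃ P : Program 𝔸, P.IsLinear ∧ P.Decides) ∨ 𝔸.HasBoundedPathwidthDuality)
    (n : ℕ) (hn : 1 ≤ n) (hHM : 𝔸.HasHagemannMitschke n) :
    (∃ r : ℕ, 1 ≤ r ∧ (maxSymProgram 𝔸 r).Decides) ∧
      ∃ P : Program 𝔸, P.IsSymmetric ∧ P.Decides := by
  obtain ⟨r, hr, hdec⟩ := exists_maxSymProgram_decides 𝔸 hlin hHM
  exact ⟨⟨r, hr, hdec⟩, maxSymProgram 𝔸 r, maxSymProgram_isSymmetric 𝔸 r, hdec⟩
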